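/- Let $T=(V,E)$ be a free tree (a finite connected acyclic graph with $n=|V|\ge 1$). A linear arrangement of $T$ is a bijection $\pi$ from $V$ to the $n$ positions $1,\dots,n$; put $D_\pi(T)=\sum_{uv\in E}|\pi(u)-\pi(v)|$ and let $C_\pi(T)$ be the number of pairs of edges that cross in $\pi$, that is, pairs $\{s,t\},\{u,v\}\in E$ with $\pi(s)<\pi(u)<\pi(t)<\pi(v)$. The arrangement is planar if $C_\pi(T)=0$; let $N_{\mathrm{pl}}(T)$ be the number of planar arrangements. Let $\mathbb P$ and $\mathbb E$ refer to an arrangement chosen uniformly at random among all $n!$ arrangements, let $\mathbb E_{\mathrm{pl}}[D(T)]$ be the expectation of $D_\pi(T)$ over a uniformly random planar arrangement, and let $\mathbb E[D(T)\mid C(T)\ge 1]$ be the expectation of $D_\pi(T)$ conditioned on $C_\pi(T)\ge 1$. Then $$\mathbb P(C(T)=0)=\frac{N_{\mathrm{pl}}(T)}{n!},\qquad \mathbb P(C(T)\ge 1)=\frac{n!-N_{\mathrm{pl}}(T)}{n!},$$ and, if some arrangement of $T$ has a crossing (so that the conditional expectation is defined), $\mathbb P(C(T)\ge 1)>0$ and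 $$\mathbb E[D(T)\mid C(T)\ge 1]=\frac{\mathbb E[D(T)]-\mathbb E_{\mathrm{pl}}[D(T)]\,\mathbb P(C(T)=0)}{\mathbb P(C(T)\ge 1)}.$$ Moreover $\mathbb E[D(T)\mid C(T)\ge 1]$ can be computed in time $O(n)$ and space $O(n)$: there are a single program for a random access machine and a constant $K$ such that, for every $n$ and every tree $T$ on $\{0,\dots,n-1\}$, given as $n$ together with a list of its edges in any order and orientation, the program halts after at most $Kn$ steps, using a constant number of variables and of arrays with $Kn$ cells each, and, if some arrangement of $T$ has a crossing, outputs exactly $\mathbb E[D(T)\mid C(T)\ge 1]$. The machine has words, natural numbers below $(n+1)^K$ (with constants, addition, truncated subtraction, comparison, and use as array indices), and exact rational numbers (with conversion from words, the four arithmetic operations and comparison; no rounding and no division by zero); every operation, memory access and test costs one step, and every variable and every array cell, word or rational number, counts as one cell. -/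

import Mathlib

open MeasureTheory ProbabilityTheory
open scoped Nat

noncomputable section

/-! ### Linear arrangements, sums of edge lengths, crossings -/

/-- A linear arrangement of an `n`-element vertex set: a bijection onto the `n` positions
(numbered from `0`; only differences and the order of positions matter). -/
abbrev Arrangement (V : Type*) [Fintype V] : Type _ := V ≃ Fin (Fintype.card V)

/-- Every set of arrangements is an event. -/
instance Arrangement.instMeasurableSpace (V : Type*) [Fintype V] :
    MeasurableSpace (Arrangement V) := ⊤

instance Arrangement.instDiscrete (V : Type*) [Fintype V] :
    DiscreteMeasurableSpace (Arrangement V) := ⟨fun _ => trivial⟩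

/-- The length `|π u - π v|` of the (potential) edge `uv`. -/
def edgeLength {V : Type*} [Fintype V] (π : Arrangement V) : Sym2 V → ℝ :=
  Sym2.lift ⟨fun u v => |((π u : ℕ) : ℝ) - ((π v : ℕ) : ℝ)|, fun _ _ => abs_sub_comm _ _⟩

open scoped Classical in
/-- The sum of the edge lengths of `T` in the arrangement `π`. -/
def sumEdgeLengths {V : Type*} [Fintype V] (T : SimpleGraph V) (π : Arrangement V) : ℝ :=
  ∑ e ∈ T.edgeFinset, edgeLength π e

/-- The number of edge crossings of `T` in `π`. A pair of crossing edges is counted through its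
unique description as `{s,t}`, `{u,v}` with `π s < π u < π t < π v`. -/
def crossings {V : Type*} [Fintype V] (T : SimpleGraph V) (π : Arrangement V) : ℕ :=
  {q : (V × V) × (V × V) | T.Adj q.1.1 q.1.2 ∧ T.Adj q.2.1 q.2.2 ∧
    π q.1.1 < π q.2.1 ∧ π q.2.1 < π q.1.2 ∧ π q.1.2 < π q.2.2}.ncard

/-- The set of planar arrangements, those without crossings. -/
def planarArrangements {V : Type*} [Fintype V] (T : SimpleGraph V) : Set (Arrangement V) :=
  {π | crossings T π = 0}

/-- The number of planar arrangements. -/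
def numPlanar {V : Type*} [Fintype V] (T : SimpleGraph V) : ℕ :=
  (planarArrangements T).ncard

/-- The law of a uniformly random arrangement. -/
def arrangementLaw (V : Type*) [Fintype V] : Measure (Arrangement V) :=
  uniformOn Set.univ

/-- The probability that a uniformly random arrangement has no crossing. -/
def probNoCrossing {V : Type*} [Fintype V] (T : SimpleGraph V) : ℝ :=
  (arrangementLaw V).real {π | crossings T π = 0}

/-- The probability that a uniformly random arrangement has at least one crossing. -/
def probCrossing {V : Type*} [Fintype V] (T : SimpleGraph V) : ℝ :=
  (arrangementLaw V).real {π | 1 ≤ crossings T π}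

/-- The expected sum of edge lengths in a uniformly random arrangement. -/
def expSumLengths {V : Type*} [Fintype V] (T : SimpleGraph V) : ℝ :=
  ∫ π, sumEdgeLengths T π ∂(arrangementLaw V)

/-- The expected sum of edge lengths in a uniformly random planar arrangement. -/
def expSumLengthsPlanar {V : Type*} [Fintype V] (T : SimpleGraph V) : ℝ :=
  ∫ π, sumEdgeLengths T π ∂(uniformOn (planarArrangements T))

/-- The expected sum of edge lengths in a uniformly random arrangement, conditioned on the event
that there is at least one crossing. -/
def expSumLengthsCrossing {V : Type*} [Fintype V] (T : SimpleGraph V) : ℝ :=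
  ∫ π, sumEdgeLengths T π ∂((arrangementLaw V)[|{π | 1 ≤ crossings T π}])

/-! ### A unit-cost random access machine

The machine has word (natural number) variables, arrays of words, variables for exact rational
numbers, and arrays of such numbers. A program names only finitely many variables and arrays.
Arrays have `S` cells, so that a fixed program uses `O(S)` cells of memory altogether, and words
have to stay below `W`. An operation on words or numbers, a memory access and a test cost one
step each. -/

namespace RAM

/-- The contents of the memory. -/
structure State where
  /-- word variables -/
  word : ℕ → ℕ
  /-- arrays of words: `wordArr a i` is the cell `i` of the array `a` -/
  wordArr : ℕ → ℕ → ℕ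
  /-- number variables -/
  num : ℕ → ℚ
  /-- arrays of numbers -/
  numArr : ℕ → ℕ → ℚ

/-- Elementary instructions. The natural numbers `x y z` name variables, `a` names an array. -/
inductive Instr where
  /-- `x := c` for a constant word -/
  | wordConst (x c : ℕ)
  /-- `x := y + z` on words -/
  | wordAdd (x y z : ℕ)
  /-- `x := y - z` on words, truncated at zero -/
  | wordSub (x y z : ℕ)
  /-- `x := a[i]` on words, where `i` is a word variable -/
  | wordLoad (x a i : ℕ)
  /-- `a[i] := x` on words -/
  | wordStore (a i x : ℕ)
  /-- copy the word variable `y` to the number variable `x` -/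
  | numOfWord (x y : ℕ)
  /-- `x := y + z` on numbers -/
  | numAdd (x y z : ℕ)
  /-- `x := y - z` on numbers -/
  | numSub (x y z : ℕ)
  /-- `x := y * z` on numbers -/
  | numMul (x y z : ℕ)
  /-- `x := y / z` on numbers -/
  | numDiv (x y z : ℕ)
  /-- `x := a[i]` on numbers, where `i` is a word variable -/
  | numLoad (x a i : ℕ)
  /-- `a[i] := x` on numbers, where `i` is a word variable -/
  | numStore (a i x : ℕ)

/-- When an instruction can be executed: words stay below `W`, array indices stay below `S`,
and there is no division by zero. -/
def Instr.Legal (S W : ℕ) (σ : State) : Instr → Prop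
  | .wordConst _ c => c < W
  | .wordAdd _ y z => σ.word y + σ.word z < W
  | .wordSub _ _ _ => True
  | .wordLoad _ _ i => σ.word i < S
  | .wordStore _ i _ => σ.word i < S
  | .numOfWord _ _ => True
  | .numAdd _ _ _ => True
  | .numSub _ _ _ => True
  | .numMul _ _ _ => True
  | .numDiv _ _ z => σ.num z ≠ 0
  | .numLoad _ _ i => σ.word i < S
  | .numStore _ i _ => σ.word i < S

/-- The effect of an instruction. -/
def Instr.apply (σ : State) : Instr → State
  | .wordConst x c => { σ with word := Function.update σ.word x c }
  | .wordAdd x y z => { σ with word := Function.update σ.word x (σ.word y + σ.word z) }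
  | .wordSub x y z => { σ with word := Function.update σ.word x (σ.word y - σ.word z) }
  | .wordLoad x a i => { σ with word := Function.update σ.word x (σ.wordArr a (σ.word i)) }
  | .wordStore a i x =>
      let row := Function.update (σ.wordArr a) (σ.word i) (σ.word x)
      { σ with wordArr := Function.update σ.wordArr a row }
  | .numOfWord x y => { σ with num := Function.update σ.num x (σ.word y : ℚ) }
  | .numAdd x y z => { σ with num := Function.update σ.num x (σ.num y + σ.num z) }
  | .numSub x y z => { σ with num := Function.update σ.num x (σ.num y - σ.num z) }
  | .numMul x y z => { σ with num := Function.update σ.num x (σ.num y * σ.num z) }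
  | .numDiv x y z => { σ with num := Function.update σ.num x (σ.num y / σ.num z) }
  | .numLoad x a i => { σ with num := Function.update σ.num x (σ.numArr a (σ.word i)) }
  | .numStore a i x =>
      let row := Function.update (σ.numArr a) (σ.word i) (σ.num x)
      { σ with numArr := Function.update σ.numArr a row }

/-- Tests: comparison of two word variables, or of two number variables. -/
inductive Test where
  | wordLt (x y : ℕ)
  | numLt (x y : ℕ)

/-- When a test succeeds. -/
def Test.Holds (σ : State) : Test → Prop
  | .wordLt x y => σ.word x < σ.word y
  | .numLt x y => σ.num x < σ.num y

/-- Programs. -/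
inductive Prog where
  | skip
  | instr (c : Instr)
  | seq (p q : Prog)
  | ite (b : Test) (p q : Prog)
  | loop (b : Test) (p : Prog)

/-- `Exec S W p σ t σ'`: with arrays of `S` cells and words below `W`, the program `p` started
in `σ` halts after `t` steps in `σ'`, without ever performing an illegal instruction.
Here `loop b p` runs `p` as long as `b` holds. -/
inductive Exec (S W : ℕ) : Prog → State → ℕ → State → Prop where
  | skip (σ : State) : Exec S W .skip σ 0 σ
  | instr (c : Instr) (σ : State) (h : c.Legal S W σ) : Exec S W (.instr c) σ 1 (c.apply σ)
  | seq {p q : Prog} {σ σ' σ'' : State} {t t' : ℕ}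
      (hp : Exec S W p σ t σ') (hq : Exec S W q σ' t' σ'') :
      Exec S W (.seq p q) σ (t + t') σ''
  | ite_true {b : Test} {p q : Prog} {σ σ' : State} {t : ℕ} (h : b.Holds σ)
      (hp : Exec S W p σ t σ') : Exec S W (.ite b p q) σ (t + 1) σ'
  | ite_false {b : Test} {p q : Prog} {σ σ' : State} {t : ℕ} (h : ¬ b.Holds σ)
      (hq : Exec S W q σ t σ') : Exec S W (.ite b p q) σ (t + 1) σ'
  | loop_true {b : Test} {p : Prog} {σ σ' σ'' : State} {t t' : ℕ} (h : b.Holds σ)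
      (hp : Exec S W p σ t σ') (hl : Exec S W (.loop b p) σ' t' σ'') :
      Exec S W (.loop b p) σ (t + t' + 1) σ''
  | loop_false {b : Test} {p : Prog} {σ : State} (h : ¬ b.Holds σ) :
      Exec S W (.loop b p) σ 1 σ

/-- `l` lists every edge of `T` exactly once, in any order and each with either orientation. -/
def IsEdgeList {n : ℕ} (T : SimpleGraph (Fin n)) (l : List (Fin n × Fin n)) : Prop :=
  (l.map fun e => s(e.1, e.2)).Nodup ∧ ∀ e, e ∈ (l.map fun e => s(e.1, e.2)) ↔ e ∈ T.edgeSet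

/-- The memory at the start: the word variable `0` holds the number `n` of vertices, the word
arrays `0` and `1` hold the two end points of the listed edges, all the rest is zero. -/
def input {n : ℕ} (l : List (Fin n × Fin n)) : State where
  word := Function.update (fun _ => 0) 0 n
  wordArr a i :=
    if a = 0 then (l.map fun e => (e.1 : ℕ)).getD i 0
    else if a = 1 then (l.map fun e => (e.2 : ℕ)).getD i 0
    else 0
  num _ := 0
  numArr _ _ := 0

end RAM

end

/-!
Having no crossing is invariant under cyclic rotation, so the planar arrangements are the `n`
rotations of those that start at a fixed vertex. In a planar arrangement listed from a root, each
branch occupies an interval, so a new leaf at `p` fits into exactly `deg p + 1` gaps; growing the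
tree leaf by leaf gives `N_pl = n ∏ deg!`.

For an edge `uv`, let `i` be the index of `v` in a planar list starting at `u`. Over the `n`
rotations of this list the lengths of `uv` sum to `2 i (n - i)`, and `(i - 1) (n - 1 - i)` counts
the pairs `(w, w')` such that `w` comes between `u` and `v`, and `w'` after `v`. Two vertices in the
same branch at `u` or `v` are never separated like this; otherwise it is decided on a subtree with
four vertices, and growing the tree from there gives a share of `1 / 6` of the planar lists if that
subtree is a star, and of `1 / 4` if it is a path. Hence `E_pl[D]` is a sum over the edges of a
polynomial in the sizes of the two sides, and with `E[D] = (n² - 1) / 3` the law of total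
expectation yields the conditional expectation.

The machine stores for each vertex its degree and the sum of its neighbours. The neighbour of a
leaf is then its neighbour sum, so leaves can be deleted in `O(1)` steps each without adjacency
lists, while the sizes of the deleted branches are accumulated at their attachment points.
-/

/-! ### Branches of a tree -/

section Branches

variable {V : Type*} {T : SimpleGraph V}

/-- `ReachableWithin T P a b` says that `a = b`, or `a` and `b` are joined by a walk of `T` all of
whose vertices satisfy `P`. Unlike reachability in an induced subgraph it needs no membership
proofs for `a` and `b`. -/
def ReachableWithin (T : SimpleGraph V) (P : V → Prop) : V → V → Prop :=
  Relation.ReflTransGen fun x y => T.Adj x y ∧ P x ∧ P y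

namespace ReachableWithin

variable {P Q : V → Prop} {a b c : V}

theorem symm (h : ReachableWithin T P a b) : ReachableWithin T P b a :=
  have : Std.Symm fun x y => T.Adj x y ∧ P x ∧ P y := ⟨fun _ _ h => ⟨h.1.symm, h.2.2, h.2.1⟩⟩
  Relation.ReflTransGen.stdSymm.symm _ _ h

theorem trans (h : ReachableWithin T P a b) (h' : ReachableWithin T P b c) :
    ReachableWithin T P a c :=
  Relation.ReflTransGen.trans h h'

theorem mono (hPQ : ∀ x, P x → Q x) (h : ReachableWithin T P a b) : ReachableWithin T Q a b :=
  Relation.ReflTransGen.mono (fun _ _ h => ⟨h.1, hPQ _ h.2.1, hPQ _ h.2.2⟩) _ _ h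

theorem of_adj (h : T.Adj a b) (ha : P a) (hb : P b) : ReachableWithin T P a b :=
  .single ⟨h, ha, hb⟩

theorem of_preconnected (hT : T.Preconnected) (a b : V) :
    ReachableWithin T (fun _ => True) a b :=
  Relation.ReflTransGen.mono (fun _ _ h => ⟨h, trivial, trivial⟩) _ _
    ((SimpleGraph.reachable_iff_reflTransGen a b).1 (hT a b))

theorem reachable (h : ReachableWithin T P a b) : T.Reachable a b :=
  (SimpleGraph.reachable_iff_reflTransGen a b).2
    (Relation.ReflTransGen.mono (fun _ _ h => h.1) _ _ h)

theorem prop_right (h : ReachableWithin T P a b) (ha : P a) : P b := by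
  rcases Relation.ReflTransGen.cases_tail h with h | ⟨c, -, h⟩
  · exact h ▸ ha
  · exact h.2.2

theorem and_reachableWithin (h : ReachableWithin T P a b) :
    ReachableWithin T (fun x => P x ∧ ReachableWithin T P a x) a b := by
  induction h with
  | refl => exact .refl
  | tail hab hbc ih => exact ih.tail ⟨hbc.1, ⟨hbc.2.1, hab⟩, hbc.2.2, hab.tail hbc⟩

theorem exists_adj_reachableWithin_ne {p : V} (h : ReachableWithin T P b p) (hb : b ≠ p) :
    ∃ q, T.Adj p q ∧ P q ∧ ReachableWithin T (fun x => P x ∧ x ≠ p) q b := by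
  induction h using Relation.ReflTransGen.head_induction_on with
  | refl => exact absurd rfl hb
  | @head a c hac _ ih =>
    by_cases hc : c = p
    · subst hc
      exact ⟨a, hac.1.symm, hac.2.1, .refl⟩
    · obtain ⟨q, hq, hPq, hqc⟩ := ih hc
      exact ⟨q, hq, hPq, hqc.trans (.of_adj hac.1.symm ⟨hac.2.2, hc⟩ ⟨hac.2.1, hb⟩)⟩

theorem exists_adj_of_not (h : ReachableWithin T P a b) (ha : Q a) (hb : ¬ Q b) :
    ∃ x y, T.Adj x y ∧ P x ∧ P y ∧ Q x ∧ ¬ Q y := by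
  induction h using Relation.ReflTransGen.head_induction_on with
  | refl => exact absurd ha hb
  | @head a c hac _ ih =>
    by_cases hc : Q c
    · exact ih hc
    · exact ⟨a, c, hac.1, hac.2.1, hac.2.2, ha, hc⟩

/-- Otherwise the edge `pq` could be bypassed through `q'`, although it is a bridge. -/
theorem eq_of_adj_of_adj (hT : T.IsAcyclic) {p q q' : V} (hq : T.Adj p q) (hq' : T.Adj p q')
    (h : ReachableWithin T (· ≠ p) q q') : q = q' := by
  by_contra hne
  have hbridge := SimpleGraph.isBridge_iff.1
    (SimpleGraph.isAcyclic_iff_forall_adj_isBridge.1 hT hq)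
  have hadj : (T \ SimpleGraph.fromEdgeSet {s(p, q)}).Adj p q' := by
    simp [hq', hq'.ne', Ne.symm hne]
  have hbypass : ReachableWithin (T \ SimpleGraph.fromEdgeSet {s(p, q)}) (· ≠ p) q' q :=
    Relation.ReflTransGen.mono
      (fun x y hxy => ⟨by simp [hxy.1, hxy.2.1, hxy.2.2], hxy.2⟩) _ _ h.symm
  exact hbridge (hadj.reachable.trans hbypass.reachable)

theorem and_ne_of_adj (hT : T.IsAcyclic) {p q q' x : V} (hq : T.Adj p q) (hq' : T.Adj p q')
    (hne : q ≠ q') (h : ReachableWithin T (· ≠ p) q x) :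
    ReachableWithin T (fun y => y ≠ p ∧ y ≠ q') q x :=
  h.and_reachableWithin.mono fun _ hy =>
    ⟨hy.1, fun hyq' => hne (eq_of_adj_of_adj hT hq hq' (hyq' ▸ hy.2))⟩

end ReachableWithin

open scoped Classical in
/-- The neighbour of `p` through which a tree leads from `p` to `x`, which names the branch at `p`
that contains `x`. The value is `p` if there is no such neighbour, as for `x = p` in a tree. -/
noncomputable def branch (T : SimpleGraph V) (p x : V) : V :=
  if h : ∃ q, T.Adj p q ∧ ReachableWithin T (· ≠ p) q x then h.choose else p

theorem branch_eq (hT : T.IsAcyclic) {p q x : V} (hq : T.Adj p q)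
    (h : ReachableWithin T (· ≠ p) q x) : branch T p x = q := by
  have hex : ∃ q, T.Adj p q ∧ ReachableWithin T (· ≠ p) q x := ⟨q, hq, h⟩
  rw [branch, dif_pos hex]
  exact ReachableWithin.eq_of_adj_of_adj hT hex.choose_spec.1 hq (hex.choose_spec.2.trans h.symm)

theorem branch_eq_of_adj (hT : T.IsAcyclic) {p q : V} (hq : T.Adj p q) : branch T p q = q :=
  branch_eq hT hq .refl

theorem branch_spec (hT : T.Preconnected) {p x : V} (hx : x ≠ p) :
    T.Adj p (branch T p x) ∧ ReachableWithin T (· ≠ p) (branch T p x) x := by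
  obtain ⟨q, hq, -, hqx⟩ :=
    (ReachableWithin.of_preconnected hT x p).exists_adj_reachableWithin_ne hx
  have hex : ∃ q, T.Adj p q ∧ ReachableWithin T (· ≠ p) q x := ⟨q, hq, hqx.mono fun _ h => h.2⟩
  rw [branch, dif_pos hex]
  exact hex.choose_spec

theorem adj_branch (hT : T.Preconnected) {p x : V} (hx : x ≠ p) : T.Adj p (branch T p x) :=
  (branch_spec hT hx).1

theorem reachableWithin_branch (hT : T.Preconnected) {p x : V} (hx : x ≠ p) :
    ReachableWithin T (· ≠ p) (branch T p x) x :=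
  (branch_spec hT hx).2

theorem branch_eq_branch (hT : T.IsTree) {p x y : V} (hx : x ≠ p)
    (h : ReachableWithin T (· ≠ p) x y) : branch T p y = branch T p x :=
  branch_eq hT.2 (adj_branch hT.1.preconnected hx)
    ((reachableWithin_branch hT.1.preconnected hx).trans h)

theorem branch_eq_of_branch_ne (hT : T.IsTree) {p q x : V} (hpq : T.Adj p q) (hxp : x ≠ p)
    (h : branch T p x ≠ q) : x ≠ q ∧ branch T q x = p := by
  have hb := adj_branch hT.1.preconnected hxp
  have hpx : ReachableWithin T (· ≠ q) p x :=
    .trans (.of_adj hb hpq.ne h) (((reachableWithin_branch hT.1.preconnected hxp).and_ne_of_adj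
      hT.2 hb hpq h).mono fun _ h => h.2)
  exact ⟨hpx.prop_right hpq.ne, branch_eq hT.2 hpq.symm hpx⟩

theorem branch_ne_of_branch_eq (hT : T.IsTree) {p q x : V} (hpq : T.Adj p q) (hxp : x ≠ p)
    (hxq : x ≠ q) (h : branch T q x = p) : branch T p x ≠ q := by
  intro h'
  have hpx := reachableWithin_branch hT.1.preconnected hxq
  have hqx := reachableWithin_branch hT.1.preconnected hxp
  rw [h] at hpx
  rw [h'] at hqx
  obtain ⟨r, hr, hrq, hrx⟩ := hpx.symm.exists_adj_reachableWithin_ne hxp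
  have hrq' := (hrx.mono fun _ h => h.2).trans hqx.symm
  exact hrq (ReachableWithin.eq_of_adj_of_adj hT.2 hr hpq hrq')

section Side

variable [Fintype V] [DecidableEq V]

/-- The vertices on the side of `q` of an edge `pq` of a tree: those that remain connected to `q`
when the edge is deleted. -/
noncomputable def side (T : SimpleGraph V) (p q : V) : Finset V :=
  {x | x ≠ p ∧ branch T p x = q}

theorem mem_side {p q x : V} : x ∈ side T p q ↔ x ≠ p ∧ branch T p x = q := by
  simp [side]

theorem mem_side_self (hT : T.IsAcyclic) {p q : V} (hpq : T.Adj p q) : q ∈ side T p q :=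
  mem_side.2 ⟨hpq.ne', branch_eq_of_adj hT hpq⟩

theorem compl_side (hT : T.IsTree) {p q : V} (hpq : T.Adj p q) :
    (side T p q)ᶜ = side T q p := by
  ext x
  rw [Finset.mem_compl, mem_side, mem_side]
  constructor
  · intro h
    by_cases hxp : x = p
    · subst hxp
      exact ⟨hpq.ne, branch_eq_of_adj hT.2 hpq.symm⟩
    · exact branch_eq_of_branch_ne hT hpq hxp fun h' => h ⟨hxp, h'⟩
  · rintro ⟨hxq, h⟩ ⟨hxp, h'⟩
    exact branch_ne_of_branch_eq hT hpq hxp hxq h h'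

theorem card_side_add_card_side (hT : T.IsTree) {p q : V} (hpq : T.Adj p q) :
    (side T p q).card + (side T q p).card = Fintype.card V := by
  rw [← compl_side hT hpq, Finset.card_add_card_compl]

theorem sum_card_side_add_one [DecidableRel T.Adj] (hT : T.IsTree) (p : V) :
    ∑ q ∈ T.neighborFinset p, (side T p q).card + 1 = Fintype.card V := by
  have hfibers : (Finset.univ.erase p).card = ∑ q ∈ T.neighborFinset p,
      {x ∈ Finset.univ.erase p | branch T p x = q}.card :=
    Finset.card_eq_sum_card_fiberwise fun x hx => by
      simpa using adj_branch hT.1.preconnected (by simpa using hx)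
  have hside (q : V) : side T p q = {x ∈ Finset.univ.erase p | branch T p x = q} := by
    ext x
    simp [mem_side]
  rw [← Finset.card_univ, ← Finset.card_erase_add_one (Finset.mem_univ p), hfibers]
  simp only [hside]

end Side

end Branches

/-! ### Noncrossing lists -/

section Lists

variable {α : Type*}

theorem length_eq_card [Fintype α] {l : List α} (hn : l.Nodup) (hm : ∀ x, x ∈ l) :
    l.length = Fintype.card α := by
  classical
  rw [← List.toFinset_card_of_nodup hn, Finset.card_eq_iff_eq_univ]
  exact Finset.eq_univ_of_forall fun x => List.mem_toFinset.2 (hm x)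

theorem eq_of_isRotated_of_head?_eq {l l' : List α} (hn : l.Nodup) (h : l ~r l')
    (hhead : l.head? = l'.head?) : l = l' := by
  obtain ⟨k, hk, rfl⟩ := List.isRotated_iff_mod.1 h
  rcases hk.lt_or_eq with hk | rfl
  · rw [List.head?_rotate hk, List.head?_eq_getElem?] at hhead
    obtain rfl : 0 = k := (List.getElem?_inj (by omega) hn).1 hhead
    exact (List.rotate_zero l).symm
  · exact (List.rotate_length l).symm

theorem head?_rotate_idxOf [DecidableEq α] {l : List α} {a : α} (ha : a ∈ l) :
    (l.rotate (l.idxOf a)).head? = some a := by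
  rw [List.head?_rotate (List.idxOf_lt_length_iff.2 ha), List.getElem?_idxOf ha]

theorem sublist_iff_forall_mem_and_pairwise {pos : α → ℕ} {l : List α}
    (hl : l.Pairwise fun a b => pos a < pos b) (l' : List α) :
    l'.Sublist l ↔ (∀ x ∈ l', x ∈ l) ∧ l'.Pairwise fun a b => pos a < pos b := by
  refine ⟨fun h => ⟨fun x hx => h.subset hx, hl.sublist h⟩, fun ⟨hsub, hl'⟩ => ?_⟩
  have : Std.Antisymm fun a b : α => pos a < pos b := ⟨fun _ _ h h' => absurd h (lt_asymm h')⟩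
  have hn : l'.Nodup := hl'.imp fun h => ne_of_apply_ne pos h.ne
  exact List.sublist_of_subperm_of_pairwise (List.subperm_of_subset hn hsub) hl' hl

theorem pairwise_idxOf_lt [DecidableEq α] {l : List α} (hn : l.Nodup) :
    l.Pairwise fun a b => l.idxOf a < l.idxOf b := by
  rw [List.pairwise_iff_getElem]
  intro i j hi hj hij
  rwa [hn.idxOf_getElem, hn.idxOf_getElem]

theorem mem_and_mem_of_sublist_append_cons {u a v : α} {x y : List α}
    (h : [u, a, v].Sublist (x ++ a :: y)) (hx : a ∉ x) (hy : a ∉ y) : u ∈ x ∧ v ∈ y := by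
  obtain ⟨l₁, l₂, heq, h₁, h₂⟩ := List.sublist_append_iff.1 h
  rcases l₁ with _ | ⟨b, _ | ⟨c, l₁⟩⟩
  · obtain rfl : [u, a, v] = l₂ := heq
    rcases List.sublist_cons_iff.1 h₂ with h₂ | ⟨l, hl, h₂⟩
    · exact absurd (h₂.subset (by simp)) hy
    · obtain rfl := (List.cons.inj hl).2
      exact absurd (h₂.subset (by simp)) hy
  · obtain ⟨rfl, rfl⟩ : u = b ∧ [a, v] = l₂ := by simpa using heq
    exact ⟨h₁.subset (by simp), (List.cons_sublist_cons.1 h₂).subset (by simp)⟩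
  · obtain ⟨rfl, rfl, -⟩ : u = b ∧ a = c ∧ _ := by simpa using heq
    exact absurd (h₁.subset (by simp)) hx

theorem eq_of_take_append_cons_drop_eq {a : α} {m : List α} (ha : a ∉ m) {j k : ℕ}
    (hj : j ≤ m.length) (hk : k ≤ m.length)
    (h : m.take j ++ a :: m.drop j = m.take k ++ a :: m.drop k) : j = k := by
  classical
  have hidx : ∀ i ≤ m.length, (m.take i ++ a :: m.drop i).idxOf a = i := fun i hi => by
    rw [List.idxOf_append_of_notMem fun h => ha (List.mem_of_mem_take h), List.idxOf_cons_self,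
      List.length_take, min_eq_left hi, add_zero]
  rw [← hidx j hj, h, hidx k hk]

variable [DecidableEq α]

theorem filter_ne_append_cons {a : α} {x y : List α} (hx : a ∉ x) (hy : a ∉ y) :
    (x ++ a :: y).filter (· ≠ a) = x ++ y := by
  rw [List.filter_append, List.filter_cons_of_neg (by simp), List.filter_eq_self.2,
    List.filter_eq_self.2]
  all_goals
    intro b hb
    grind

theorem exists_eq_take_append_cons_drop {a : α} {l : List α} (hn : l.Nodup) (ha : a ∈ l) :
    ∃ k ≤ (l.filter (· ≠ a)).length,
      l = (l.filter (· ≠ a)).take k ++ a :: (l.filter (· ≠ a)).drop k := by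
  obtain ⟨x, y, rfl⟩ := List.append_of_mem ha
  have hxy := (List.nodup_cons.1 (List.nodup_middle.1 hn)).1
  rw [List.mem_append, not_or] at hxy
  rw [filter_ne_append_cons hxy.1 hxy.2]
  exact ⟨x.length, by simp, by simp⟩

/-- A cut survives the removal of the first element `a`, except that the two cuts next to `a`
become one if `a` continues the class that follows it. -/
theorem card_filter_cuts {β : Type*} [DecidableEq β] (f : α → β) (m : List α)
    (hm : ∀ a b c, [a, b, c].Sublist m → f a = f c → f b = f a) :
    {k ∈ Finset.range (m.length + 1) | ∀ a ∈ m.take k, ∀ b ∈ m.drop k, f a ≠ f b}.card =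
      (m.toFinset.image f).card + 1 := by
  induction m with
  | nil => simp
  | cons a m ih =>
    specialize ih fun x y z h => hm x y z (h.cons a)
    rw [Finset.card_filter, List.length_cons, Finset.sum_range_succ']
    simp only [List.take_zero, List.not_mem_nil, false_implies, implies_true, if_true,
      List.take_succ_cons, List.drop_succ_cons, List.mem_cons, forall_eq_or_imp]
    congr 1
    rw [List.toFinset_cons, Finset.image_insert]
    by_cases ha : f a ∈ m.toFinset.image f
    · obtain ⟨c, hc, hca⟩ := Finset.mem_image.1 ha
      rw [List.mem_toFinset] at hc
      have hne : ¬ ∀ b ∈ m, f a ≠ f b := fun h => h c hc hca.symm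
      rw [Finset.insert_eq_of_mem ha, ← Nat.add_left_inj (n := 1), ← ih, Finset.card_filter,
        Finset.sum_range_succ', Finset.sum_range_succ', if_neg (by simpa using hne),
        if_pos (by simp), add_zero]
      congr 1
      refine Finset.sum_congr rfl fun k _ => if_congr (and_iff_right_of_imp ?_) rfl rfl
      obtain ⟨b, m, rfl⟩ := List.exists_cons_of_ne_nil (List.ne_nil_of_mem hc)
      have hb : f b = f a := by
        rcases List.mem_cons.1 hc with rfl | hc
        · exact hca
        · exact hm a b c (((List.singleton_sublist.2 hc).cons_cons b).cons_cons a) hca.symm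
      exact fun h x hx => hb ▸ h b (by simp) x hx
    · rw [Finset.card_insert_of_notMem ha, ← ih, Finset.card_filter]
      refine Finset.sum_congr rfl fun k _ => if_congr (and_iff_right_of_imp fun _ x hx hax => ?_)
        rfl rfl
      exact ha (Finset.mem_image.2 ⟨x, by simpa using List.mem_of_mem_drop hx, hax.symm⟩)

end Lists

section Noncrossing

variable {V : Type*} {T : SimpleGraph V} {S : Finset V} {l l' : List V}

/-- No two edges of `T` cross when the vertices are written in the order of `l`. -/
def Noncrossing (T : SimpleGraph V) (l : List V) : Prop :=
  ∀ s u t v, T.Adj s t → T.Adj u v → ¬ [s, u, t, v].Sublist l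

theorem Noncrossing.sublist (h : Noncrossing T l) (hl : l'.Sublist l) : Noncrossing T l' :=
  fun s u t v hst huv h' => h s u t v hst huv (h'.trans hl)

theorem Noncrossing.append_singleton {a : V} (h : Noncrossing T (a :: l)) :
    Noncrossing T (l ++ [a]) := by
  intro s u t v hst huv hsub
  obtain ⟨l₁, l₂, heq, h₁, h₂⟩ := List.sublist_append_iff.1 hsub
  rcases List.sublist_singleton.1 h₂ with rfl | rfl
  · rw [List.append_nil] at heq
    subst heq
    exact h s u t v hst huv (h₁.cons a)
  · obtain ⟨rfl, hva⟩ := List.append_inj' (s₁ := [s, u, t]) (t₁ := [v]) heq rfl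
    obtain rfl : v = a := by simpa using hva
    exact h v s u t huv.symm hst (h₁.cons_cons v)

theorem Noncrossing.isRotated (h : Noncrossing T l) (hl : l ~r l') : Noncrossing T l' := by
  obtain ⟨k, rfl⟩ := hl
  induction k generalizing l with
  | zero => simpa using h
  | succ k ih =>
    cases l with
    | nil => simpa using h
    | cons a l =>
      rw [List.rotate_cons_succ]
      exact ih h.append_singleton

theorem Noncrossing.not_lt {pos : V → ℕ} (h : Noncrossing T l)
    (hl : l.Pairwise fun a b => pos a < pos b) {s u t v : V} (hs : s ∈ l) (hu : u ∈ l)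
    (ht : t ∈ l) (hv : v ∈ l) (hst : T.Adj s t) (huv : T.Adj u v) (hsu : pos s < pos u)
    (hut : pos u < pos t) : ¬ pos t < pos v := by
  intro htv
  refine h s u t v hst huv ((sublist_iff_forall_mem_and_pairwise hl _).2 ⟨by simp [*], ?_⟩)
  grind [List.pairwise_cons]

variable [DecidableEq V]

/-- In a noncrossing order a walk that avoids both ends of an edge `st` cannot leave the interval
between `s` and `t`. -/
theorem Noncrossing.idxOf_between_of_reachableWithin (hl : Noncrossing T l) (hn : l.Nodup)
    {s t a b : V} (hst : T.Adj s t) (hs : s ∈ l) (ht : t ∈ l)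
    (hab : ReachableWithin T (fun x => x ∈ l ∧ x ≠ s ∧ x ≠ t) a b)
    (ha : l.idxOf s < l.idxOf a ∧ l.idxOf a < l.idxOf t) :
    l.idxOf s < l.idxOf b ∧ l.idxOf b < l.idxOf t := by
  by_contra hb
  obtain ⟨x, y, hxy, hx, hy, hQx, hQy⟩ := hab.exists_adj_of_not
    (Q := fun x => l.idxOf s < l.idxOf x ∧ l.idxOf x < l.idxOf t) ha hb
  have hys : l.idxOf y ≠ l.idxOf s := fun h => hy.2.1 ((List.idxOf_inj hy.1).1 h)
  have hyt : l.idxOf y ≠ l.idxOf t := fun h => hy.2.2 ((List.idxOf_inj hy.1).1 h)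
  have hyx := hl.not_lt (pairwise_idxOf_lt hn) hy.1 hs hx.1 ht hxy.symm hst
  have hxy := hl.not_lt (pairwise_idxOf_lt hn) hs hx.1 ht hy.1 hst hxy
  omega

open scoped Classical in
/-- The noncrossing lists that enumerate `S` and start with `r`. As the absence of crossings is
invariant under rotation, they represent the planar arrangements of `S` up to rotation. -/
noncomputable def planarLists (T : SimpleGraph V) (S : Finset V) (r : V) : Finset (List V) :=
  {l ∈ S.toList.permutations.toFinset | Noncrossing T l ∧ l.head? = some r}

theorem mem_planarLists {r : V} :
    l ∈ planarLists T S r ↔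
      l.Nodup ∧ (∀ x, x ∈ l ↔ x ∈ S) ∧ Noncrossing T l ∧ l.head? = some r := by
  simp only [planarLists, Finset.mem_filter, List.mem_toFinset, List.mem_permutations]
  rw [← and_assoc (a := l.Nodup)]
  refine and_congr_left' ⟨fun h => And.intro (h.nodup_iff.2 S.nodup_toList) fun x => ?_,
    fun h => (List.perm_ext_iff_of_nodup h.1 S.nodup_toList).2 fun x => ?_⟩
  · rw [h.mem_iff, Finset.mem_toList]
  · rw [h.2, Finset.mem_toList]

theorem cons_mem_planarLists {r : V} :
    r :: l ∈ planarLists T S r ↔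
      (r :: l).Nodup ∧ (∀ x, x ∈ r :: l ↔ x ∈ S) ∧ Noncrossing T (r :: l) := by
  simp [mem_planarLists]

theorem exists_cons_of_mem_planarLists {r : V} (hl : l ∈ planarLists T S r) :
    ∃ m, l = r :: m :=
  List.head?_eq_some_iff.1 (mem_planarLists.1 hl).2.2.2

theorem rotate_idxOf_mem_planarLists {r s : V} (hl : l ∈ planarLists T S r) (hs : s ∈ S) :
    l.rotate (l.idxOf s) ∈ planarLists T S s := by
  rw [mem_planarLists] at hl ⊢
  exact ⟨List.nodup_rotate.2 hl.1, fun x => by rw [List.mem_rotate, hl.2.1],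
    hl.2.2.1.isRotated ⟨_, rfl⟩, head?_rotate_idxOf ((hl.2.1 s).2 hs)⟩

theorem eq_of_isRotated_of_mem_planarLists {r : V} (hl : l ∈ planarLists T S r)
    (hl' : l' ∈ planarLists T S r) (h : l ~r l') : l = l' := by
  rw [mem_planarLists] at hl hl'
  exact eq_of_isRotated_of_head?_eq hl.1 h (hl.2.2.2.trans hl'.2.2.2.symm)

theorem sum_planarLists_eq_of_isRotated {M : Type*} [AddCommMonoid M] {r r' : V} (hr : r ∈ S)
    (hr' : r' ∈ S) (g : List V → M) (hg : ∀ l l', l ~r l' → g l = g l') :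
    ∑ l ∈ planarLists T S r, g l = ∑ l ∈ planarLists T S r', g l := by
  have rotated (l : List V) (a b : V) :
      (l.rotate (l.idxOf a)).rotate ((l.rotate (l.idxOf a)).idxOf b) ~r l :=
    (List.IsRotated.trans ⟨_, rfl⟩ ⟨_, rfl⟩ : l ~r _).symm
  refine Finset.sum_bij' (fun l _ => l.rotate (l.idxOf r')) (fun l _ => l.rotate (l.idxOf r))
    (fun l hl => rotate_idxOf_mem_planarLists hl hr')
    (fun l hl => rotate_idxOf_mem_planarLists hl hr) (fun l hl => ?_) (fun l hl => ?_)
    (fun l _ => hg _ _ ⟨_, rfl⟩)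
  · exact eq_of_isRotated_of_mem_planarLists (rotate_idxOf_mem_planarLists
      (rotate_idxOf_mem_planarLists hl hr') hr) hl (rotated l r' r)
  · exact eq_of_isRotated_of_mem_planarLists (rotate_idxOf_mem_planarLists
      (rotate_idxOf_mem_planarLists hl hr) hr') hl (rotated l r r')

end Noncrossing

/-! ### Growing a subtree leaf by leaf -/

section ConnectedSet

variable {V : Type*} {T : SimpleGraph V} {S : Finset V}

/-- Any two vertices in `S` are joined by a walk in `S`. -/
def ConnectedSet (T : SimpleGraph V) (S : Finset V) : Prop :=
  ∀ a ∈ S, ∀ b ∈ S, ReachableWithin T (· ∈ S) a b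

theorem connectedSet_singleton (r : V) : ConnectedSet T {r} := by
  intro a ha b hb
  rw [Finset.mem_singleton.1 ha, Finset.mem_singleton.1 hb]
  exact .refl

theorem ConnectedSet.insert_of_adj [DecidableEq V] (hS : ConnectedSet T S) {p a : V}
    (hp : p ∈ S) (hpa : T.Adj p a) : ConnectedSet T (insert a S) := by
  have to_p : ∀ x ∈ insert a S, ReachableWithin T (· ∈ insert a S) x p := by
    intro x hx
    rcases Finset.mem_insert.1 hx with rfl | hx
    · exact .of_adj hpa.symm (by simp) (by simp [hp])
    · exact (hS x hx p hp).mono fun _ h => Finset.mem_insert_of_mem h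
  exact fun x hx y hy => (to_p x hx).trans (to_p y hy).symm

theorem ConnectedSet.eq_of_adj (hT : T.IsAcyclic) (hS : ConnectedSet T S) {p q a : V}
    (hp : p ∈ S) (hq : q ∈ S) (ha : a ∉ S) (hpa : T.Adj p a) (hqa : T.Adj q a) : q = p :=
  ReachableWithin.eq_of_adj_of_adj hT hqa.symm hpa.symm
    ((hS q hq p hp).mono fun _ hx h => ha (h ▸ hx))

theorem ConnectedSet.branch_mem (hT : T.IsTree) (hS : ConnectedSet T S) {p x : V}
    (hp : p ∈ S) (hx : x ∈ S) (hxp : x ≠ p) : branch T p x ∈ S ∧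
      ReachableWithin T (fun y => y ∈ S ∧ y ≠ p ∧ branch T p y = branch T p x)
        (branch T p x) x := by
  obtain ⟨q, hq, hqS, hqx⟩ := (hS x hx p hp).exists_adj_reachableWithin_ne hxp
  have hbr : ∀ y, ReachableWithin T (fun y => y ∈ S ∧ y ≠ p) q y → branch T p y = q :=
    fun y hy => branch_eq hT.2 hq (hy.mono fun _ h => h.2)
  rw [hbr x hqx]
  exact ⟨hqS, hqx.and_reachableWithin.mono fun y hy => ⟨hy.1.1, hy.1.2, hbr y hy.2⟩⟩

theorem ConnectedSet.reachableWithin_of_branch_eq (hT : T.IsTree) (hS : ConnectedSet T S)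
    {p x y : V} (hp : p ∈ S) (hx : x ∈ S) (hxp : x ≠ p) (hy : y ∈ S) (hyp : y ≠ p)
    (h : branch T p x = branch T p y) :
    ReachableWithin T (fun z => z ∈ S ∧ z ≠ p ∧ branch T p z = branch T p x) x y :=
  (hS.branch_mem hT hp hx hxp).2.symm.trans (h ▸ (hS.branch_mem hT hp hy hyp).2)

end ConnectedSet

section DegreeIn

variable {V : Type*} {T : SimpleGraph V} [DecidableRel T.Adj]

/-- The number of neighbours of `x` in `S`. -/
def degreeIn (T : SimpleGraph V) [DecidableRel T.Adj] (S : Finset V) (x : V) : ℕ :=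
  (S.filter (T.Adj x)).card

theorem degreeIn_univ [Fintype V] (x : V) : degreeIn T Finset.univ x = T.degree x := by
  rw [degreeIn, ← SimpleGraph.card_neighborFinset_eq_degree, SimpleGraph.neighborFinset_eq_filter]

theorem degreeIn_singleton (r : V) : degreeIn T {r} r = 0 := by
  simp [degreeIn, Finset.filter_singleton]

end DegreeIn

section Insertion

variable {V : Type*} [DecidableEq V] {T : SimpleGraph V} {S : Finset V} {p : V}

/-- A branch that is left and entered again around `b` contains an edge `st` that encloses `b`,
and it crosses the edge from `p` to the branch of `b`. -/
theorem Noncrossing.branch_eq_of_sublist (hT : T.IsTree) (hS : ConnectedSet T S) {m : List V}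
    (hl : p :: m ∈ planarLists T S p) {a b c : V} (habc : [a, b, c].Sublist m)
    (hac : branch T p a = branch T p c) : branch T p b = branch T p a := by
  by_contra hne
  obtain ⟨hn, hm, hl⟩ := cons_mem_planarLists.1 hl
  have hpS : p ∈ S := (hm p).1 (by simp)
  have hne_p : ∀ x ∈ m, x ≠ p := fun x hx h => (List.nodup_cons.1 hn).1 (h ▸ hx)
  have hmS : ∀ x ∈ m, x ∈ S := fun x hx => (hm x).1 (by simp [hx])
  have ha : a ∈ m := habc.subset (by simp)
  have hb : b ∈ m := habc.subset (by simp)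
  have hc : c ∈ m := habc.subset (by simp)
  obtain ⟨-, hpos⟩ := (sublist_iff_forall_mem_and_pairwise (pairwise_idxOf_lt hn) _).1
    (habc.cons_cons p)
  simp only [List.pairwise_cons, List.mem_cons, List.not_mem_nil, or_false, forall_eq_or_imp,
    forall_eq] at hpos
  obtain ⟨s, t, hst, ⟨hs, hsp, hsa⟩, ⟨ht, -, hta⟩, hsb, htb⟩ :=
    (hS.reachableWithin_of_branch_eq hT hpS (hmS a ha) (hne_p a ha) (hmS c hc) (hne_p c hc)
      hac).exists_adj_of_not (Q := fun x => (p :: m).idxOf x < (p :: m).idxOf b)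
      (by omega) (by omega)
  have hbt : (p :: m).idxOf b ≠ (p :: m).idxOf t := fun h =>
    hne (by rw [(List.idxOf_inj (by simp [hb])).1 h, hta])
  have hbranch := hS.branch_mem hT hpS (hmS b hb) (hne_p b hb)
  have hbetween := hl.idxOf_between_of_reachableWithin hn hst ((hm s).2 hs) ((hm t).2 ht)
    (hbranch.2.symm.mono fun x hx => ⟨(hm x).2 hx.1, fun h => hne (by rw [← hx.2.2, h, hsa]),
      fun h => hne (by rw [← hx.2.2, h, hta])⟩) (by omega)
  have hps : (p :: m).idxOf p < (p :: m).idxOf s := by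
    rw [List.idxOf_cons_self, List.idxOf_cons_ne _ hsp.symm]
    exact Nat.succ_pos _
  exact hl.not_lt (pairwise_idxOf_lt hn) (by simp) ((hm s).2 hs) ((hm _).2 hbranch.1)
    ((hm t).2 ht) (adj_branch hT.1.preconnected (hne_p b hb)) hst hps hbetween.1 hbetween.2

theorem Noncrossing.branch_ne_of_insert (hT : T.IsTree) (hS : ConnectedSet T S) {a : V}
    (hpa : T.Adj p a) {x y : List V} (hxy : p :: (x ++ y) ∈ planarLists T S p)
    (h : Noncrossing T (p :: (x ++ a :: y))) {b c : V} (hb : b ∈ x) (hc : c ∈ y) :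
    branch T p b ≠ branch T p c := by
  intro hbc
  obtain ⟨hn, hm, -⟩ := cons_mem_planarLists.1 hxy
  have hmem : ∀ z ∈ x ++ y, z ∈ S ∧ z ≠ p := fun z hz =>
    ⟨(hm z).1 (List.mem_cons_of_mem p hz), fun h => (List.nodup_cons.1 hn).1 (h ▸ hz)⟩
  have hbS := hmem b (by simp [hb])
  have hcS := hmem c (by simp [hc])
  have hcx : c ∉ x := fun h => (List.nodup_append.1 (List.nodup_cons.1 hn).2).2.2 c h c hc rfl
  obtain ⟨s, t, hst, -, ⟨ht, htp, -⟩, hsx, htx⟩ :=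
    (hS.reachableWithin_of_branch_eq hT ((hm p).1 (by simp)) hbS.1 hbS.2 hcS.1 hcS.2
      hbc).exists_adj_of_not (Q := (· ∈ x)) hb hcx
  have hty : t ∈ y :=
    (List.mem_append.1 ((List.mem_cons.1 ((hm t).2 ht)).resolve_left htp)).resolve_left htx
  exact h p s a t hpa hst (((List.singleton_sublist.2 hsx).append
    ((List.singleton_sublist.2 hty).cons_cons a)).cons_cons p)

theorem noncrossing_insert (hT : T.IsTree) (hS : ConnectedSet T S) {a : V}
    (ha : a ∉ S) (hpa : T.Adj p a) {x y : List V} (hxy : p :: (x ++ y) ∈ planarLists T S p)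
    (hbr : ∀ b ∈ x, ∀ c ∈ y, branch T p b ≠ branch T p c) :
    Noncrossing T (p :: (x ++ a :: y)) := by
  obtain ⟨hn, hm, hl⟩ := cons_mem_planarLists.1 hxy
  have ham : a ∉ p :: (x ++ y) := fun h => ha ((hm a).1 h)
  obtain ⟨hap, hax, hay⟩ : a ≠ p ∧ a ∉ x ∧ a ∉ y := by simpa using ham
  have hpxy : p ∉ x ++ a :: y := by
    simpa [hap.symm] using (List.nodup_cons.1 hn).1
  intro s u t v hst huv hsub
  have hsubset : ∀ z ∈ [s, u, t, v], z = a ∨ z ∈ p :: (x ++ y) := fun z hz => by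
    have := hsub.subset hz
    simp only [List.mem_cons, List.mem_append] at this ⊢
    tauto
  have htail : ∀ z ∈ [u, t, v], z ≠ p := fun z hz h => hpxy (h ▸ hsub.tail.subset hz)
  have neighbor_eq : ∀ q ∈ [s, u, t, v], T.Adj q a → q = p := fun q hq hqa =>
    hS.eq_of_adj hT.2 ((hm p).1 (by simp))
      ((hm q).1 ((hsubset q hq).resolve_left hqa.ne)) ha hpa hqa
  have hsa : s ≠ a := by
    rintro rfl
    exact htail t (by simp) (neighbor_eq t (by simp) hst.symm)
  have hua : u ≠ a := by
    rintro rfl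
    exact htail v (by simp) (neighbor_eq v (by simp) huv.symm)
  have hva : v ≠ a := by
    rintro rfl
    exact htail u (by simp) (neighbor_eq u (by simp) huv)
  rcases eq_or_ne t a with rfl | hta
  · obtain ⟨hux, hvy⟩ := mem_and_mem_of_sublist_append_cons hsub.tail hax hay
    exact hbr u hux v hvy (branch_eq_branch hT (htail u (by simp))
      (.of_adj huv (htail u (by simp)) (htail v (by simp)))).symm
  · have hfilter := hsub.filter (fun z => decide (z ≠ a))
    rw [List.filter_eq_self.2 (by simp [*]), List.filter_cons_of_pos (by simpa using hap.symm),
      filter_ne_append_cons hax hay] at hfilter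
    exact hl s u t v hst huv hfilter

theorem filter_ne_mem_planarLists {a : V} (ha : a ∉ S) (hpa : p ≠ a) {l : List V}
    (hl : l ∈ planarLists T (insert a S) p) : l.filter (· ≠ a) ∈ planarLists T S p := by
  obtain ⟨m, rfl⟩ := exists_cons_of_mem_planarLists hl
  rw [mem_planarLists] at hl ⊢
  obtain ⟨hn, hm, hl, -⟩ := hl
  refine ⟨hn.filter _, fun x => ?_, hl.sublist List.filter_sublist, ?_⟩
  · rw [List.mem_filter, hm, Finset.mem_insert, decide_eq_true_iff]
    exact ⟨fun h => h.1.resolve_left h.2, fun hx => ⟨.inr hx, fun h => ha (h ▸ hx)⟩⟩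
  · rw [List.filter_cons_of_pos (by simpa using hpa), List.head?_cons]

theorem cons_insert_mem_planarLists_iff (hT : T.IsTree) (hS : ConnectedSet T S) {a : V}
    (ha : a ∉ S) (hpa : T.Adj p a) {x y : List V} (hxy : p :: (x ++ y) ∈ planarLists T S p) :
    p :: (x ++ a :: y) ∈ planarLists T (insert a S) p ↔
      ∀ b ∈ x, ∀ c ∈ y, branch T p b ≠ branch T p c := by
  refine ⟨fun h b hb c hc => (cons_mem_planarLists.1 h).2.2.branch_ne_of_insert hT hS hpa hxy
    hb hc, fun h => ?_⟩
  obtain ⟨hn, hm, -⟩ := cons_mem_planarLists.1 hxy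
  have hperm : (p :: (x ++ a :: y)).Perm (a :: p :: (x ++ y)) :=
    (List.perm_middle.cons p).trans (.swap _ _ _)
  refine cons_mem_planarLists.2 ⟨hperm.nodup_iff.2 (List.nodup_cons.2
    ⟨fun h => ha ((hm a).1 h), hn⟩), fun z => ?_, noncrossing_insert hT hS ha hpa hxy h⟩
  rw [hperm.mem_iff, List.mem_cons, hm, Finset.mem_insert]

variable [DecidableRel T.Adj]

theorem image_branch_eq_filter_adj (hT : T.IsTree) (hS : ConnectedSet T S) {m : List V}
    (hm : p :: m ∈ planarLists T S p) : m.toFinset.image (branch T p) = S.filter (T.Adj p) := by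
  obtain ⟨hn, hmS, -⟩ := cons_mem_planarLists.1 hm
  ext q
  simp only [Finset.mem_image, List.mem_toFinset, Finset.mem_filter]
  constructor
  · rintro ⟨x, hx, rfl⟩
    have hxp : x ≠ p := fun h => (List.nodup_cons.1 hn).1 (h ▸ hx)
    exact ⟨(hS.branch_mem hT ((hmS p).1 (by simp)) ((hmS x).1 (by simp [hx])) hxp).1,
      adj_branch hT.1.preconnected hxp⟩
  · rintro ⟨hq, hpq⟩
    exact ⟨q, (List.mem_cons.1 ((hmS q).2 hq)).resolve_left hpq.ne', branch_eq_of_adj hT.2 hpq⟩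

/-- A new leaf `a` at `p` fits exactly into the gaps between the intervals that the branches at
`p` occupy. -/
theorem card_planarLists_fiber (hT : T.IsTree) (hS : ConnectedSet T S) {a : V}
    (ha : a ∉ S) (hpa : T.Adj p a) {m : List V} (hm : m ∈ planarLists T S p) :
    {l ∈ planarLists T (insert a S) p | l.filter (· ≠ a) = m}.card = degreeIn T S p + 1 := by
  obtain ⟨m, rfl⟩ := exists_cons_of_mem_planarLists hm
  rw [degreeIn, ← image_branch_eq_filter_adj hT hS hm, ← card_filter_cuts (branch T p) m
    fun b c d => Noncrossing.branch_eq_of_sublist hT hS hm]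
  have ham : a ∉ m := fun h =>
    ha (((cons_mem_planarLists.1 hm).2.1 a).1 (List.mem_cons_of_mem p h))
  have hiff (k : ℕ) := cons_insert_mem_planarLists_iff hT hS ha hpa (x := m.take k)
    (y := m.drop k) (by rwa [List.take_append_drop])
  symm
  refine Finset.card_bij (fun k _ => p :: (m.take k ++ a :: m.drop k)) ?_ ?_ ?_
  · intro k hk
    refine Finset.mem_filter.2 ⟨(hiff k).2 (Finset.mem_filter.1 hk).2, ?_⟩
    rw [List.filter_cons_of_pos (by simpa using hpa.ne), filter_ne_append_cons
      (fun h => ham (List.mem_of_mem_take h)) fun h => ham (List.mem_of_mem_drop h),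
      List.take_append_drop]
  · intro j hj k hk h
    rw [Finset.mem_filter, Finset.mem_range, Nat.lt_succ_iff] at hj hk
    exact eq_of_take_append_cons_drop_eq ham hj.1 hk.1 (List.cons.inj h).2
  · intro l hl
    obtain ⟨hl, hlm⟩ := Finset.mem_filter.1 hl
    obtain ⟨l, rfl⟩ := exists_cons_of_mem_planarLists hl
    rw [List.filter_cons_of_pos (by simpa using hpa.ne)] at hlm
    obtain ⟨hn, hmem, -⟩ := cons_mem_planarLists.1 hl
    obtain ⟨k, hk, hlk⟩ := exists_eq_take_append_cons_drop (List.nodup_cons.1 hn).2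
      ((List.mem_cons.1 ((hmem a).2 (by simp))).resolve_left hpa.ne')
    rw [(List.cons.inj hlm).2] at hk hlk
    rw [hlk] at hl ⊢
    exact ⟨k, Finset.mem_filter.2 ⟨Finset.mem_range.2 (Nat.lt_succ_of_le hk), (hiff k).1 hl⟩,
      rfl⟩

theorem sum_planarLists_insert (hT : T.IsTree) (hS : ConnectedSet T S) {a : V}
    (ha : a ∉ S) (hpa : T.Adj p a) (g : List V → ℕ)
    (hg : ∀ l : List V, g (l.filter (· ≠ a)) = g l) :
    ∑ l ∈ planarLists T (insert a S) p, g l =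
      (degreeIn T S p + 1) * ∑ m ∈ planarLists T S p, g m := by
  rw [← Finset.sum_fiberwise_of_maps_to fun l => filter_ne_mem_planarLists ha hpa.ne,
    Finset.mul_sum]
  refine Finset.sum_congr rfl fun m hm => ?_
  rw [Finset.sum_congr rfl fun l hl => by rw [← hg l, (Finset.mem_filter.1 hl).2],
    Finset.sum_const, card_planarLists_fiber hT hS ha hpa hm, smul_eq_mul]

theorem degreeIn_insert {a : V} (ha : a ∉ S) (x : V) :
    degreeIn T (insert a S) x = degreeIn T S x + if T.Adj x a then 1 else 0 := by
  rw [degreeIn, Finset.filter_insert, degreeIn]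
  split_ifs
  · rw [Finset.card_insert_of_notMem (by simp [ha])]
  · rfl

theorem degreeIn_insert_self {a : V} (hp : p ∈ S) (hpa : T.Adj p a)
    (huniq : ∀ q ∈ S, T.Adj q a → q = p) : degreeIn T (insert a S) a = 1 := by
  rw [degreeIn, Finset.filter_insert, if_neg (T.loopless.irrefl a), Finset.card_eq_one]
  refine ⟨p, Finset.eq_singleton_iff_unique_mem.2
    ⟨Finset.mem_filter.2 ⟨hp, hpa.symm⟩, fun q hq => ?_⟩⟩
  exact huniq q (Finset.mem_filter.1 hq).1 (Finset.mem_filter.1 hq).2.symm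

theorem prod_degreeIn_insert {a : V} (hp : p ∈ S) (ha : a ∉ S) (hpa : T.Adj p a)
    (huniq : ∀ q ∈ S, T.Adj q a → q = p) :
    ∏ x ∈ insert a S, (degreeIn T (insert a S) x)! =
      (degreeIn T S p + 1) * ∏ x ∈ S, (degreeIn T S x)! := by
  have unchanged : ∀ x ∈ S.erase p, (degreeIn T (insert a S) x)! = (degreeIn T S x)! := by
    intro x hx
    rw [Finset.mem_erase] at hx
    rw [degreeIn_insert ha, if_neg fun h => hx.1 (huniq x hx.2 h), add_zero]
  rw [Finset.prod_insert ha, degreeIn_insert_self hp hpa huniq, ← Finset.mul_prod_erase _ _ hp,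
    Finset.prod_congr rfl unchanged, degreeIn_insert ha, if_pos hpa,
    ← Finset.mul_prod_erase _ (fun x => (degreeIn T S x)!) hp, Nat.factorial_one,
    Nat.factorial_succ, one_mul, mul_assoc]

end Insertion

section Growth

variable {V : Type*} [DecidableEq V] {T : SimpleGraph V}

/-- `S` arises from `S₀` by repeatedly adding a vertex that is adjacent to a present one. -/
inductive Grows (T : SimpleGraph V) (S₀ : Finset V) : Finset V → Prop
  | refl : Grows T S₀ S₀
  | step {S : Finset V} {p a : V} (h : Grows T S₀ S) (hp : p ∈ S) (ha : a ∉ S)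
      (hpa : T.Adj p a) : Grows T S₀ (insert a S)

theorem Grows.univ_of_nonempty [Fintype V] (hT : T.Preconnected) {S₀ S : Finset V}
    (h : Grows T S₀ S) (hS : S.Nonempty) : Grows T S₀ Finset.univ := by
  by_cases hu : S = Finset.univ
  · exact hu ▸ h
  · obtain ⟨x, hx⟩ : ∃ x, x ∉ S := by simpa [Finset.eq_univ_iff_forall] using hu
    obtain ⟨s, hs⟩ := hS
    obtain ⟨p, a, hpa, -, -, hp, ha⟩ :=
      (ReachableWithin.of_preconnected hT s x).exists_adj_of_not (Q := (· ∈ S)) hs hx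
    exact (h.step hp ha hpa).univ_of_nonempty hT ⟨a, by simp⟩
termination_by Fintype.card V - S.card
decreasing_by
  rw [Finset.card_insert_of_notMem ha]
  have : S.card < Fintype.card V := Finset.card_lt_univ_of_notMem hx
  omega

theorem planarLists_singleton (r : V) : planarLists T {r} r = {[r]} := by
  ext l
  rw [Finset.mem_singleton]
  constructor
  · intro hl
    obtain ⟨m, rfl⟩ := exists_cons_of_mem_planarLists hl
    obtain ⟨hn, hm, -⟩ := cons_mem_planarLists.1 hl
    rw [List.eq_nil_iff_forall_not_mem.2 fun x hx => (List.nodup_cons.1 hn).1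
      (Finset.mem_singleton.1 ((hm x).1 (List.mem_cons_of_mem r hx)) ▸ hx)]
  · rintro rfl
    refine cons_mem_planarLists.2 ⟨by simp, by simp, fun s u t v _ _ h => ?_⟩
    simpa using h.length_le

variable [DecidableRel T.Adj]

/-- Up to rotation, the restriction of a uniformly random planar arrangement of a tree to a
subtree is again uniformly random. -/
theorem Grows.sum_planarLists (hT : T.IsTree) {S₀ S : Finset V} (h : Grows T S₀ S)
    (hS₀ : ConnectedSet T S₀) (g : List V → ℕ) (hrot : ∀ l l', l ~r l' → g l = g l')
    (hg : ∀ a ∉ S₀, ∀ l : List V, g (l.filter (· ≠ a)) = g l) :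
    ConnectedSet T S ∧ S₀ ⊆ S ∧ ∀ r₀ ∈ S₀, ∀ r ∈ S,
      (∏ x ∈ S₀, (degreeIn T S₀ x)!) * ∑ l ∈ planarLists T S r, g l =
        (∏ x ∈ S, (degreeIn T S x)!) * ∑ l ∈ planarLists T S₀ r₀, g l := by
  induction h with
  | refl =>
    exact ⟨hS₀, subset_rfl, fun r₀ h₀ r hr => by
      rw [sum_planarLists_eq_of_isRotated h₀ hr g hrot]⟩
  | @step S p a _ hp ha hpa ih =>
    obtain ⟨hS, hsub, ih⟩ := ih
    refine ⟨hS.insert_of_adj hp hpa, hsub.trans (Finset.subset_insert a S),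
      fun r₀ h₀ r hr => ?_⟩
    rw [sum_planarLists_eq_of_isRotated hr (Finset.mem_insert_of_mem hp) g hrot,
      sum_planarLists_insert hT hS ha hpa g (hg a fun h => ha (hsub h)),
      prod_degreeIn_insert hp ha hpa fun q hq hqa => hS.eq_of_adj hT.2 hp hq ha hpa hqa,
      mul_left_comm, ih r₀ h₀ p hp, mul_assoc]

theorem card_planarLists_univ [Fintype V] (hT : T.IsTree) (r : V) :
    (planarLists T Finset.univ r).card = ∏ x, (T.degree x)! := by
  have hgrow : Grows T {r} Finset.univ :=
    Grows.refl.univ_of_nonempty hT.1.preconnected ⟨r, by simp⟩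
  have h := (hgrow.sum_planarLists hT (connectedSet_singleton r) (fun _ => 1)
    (fun _ _ _ => rfl) fun _ _ _ => rfl).2.2 r (by simp) r (by simp)
  simpa [degreeIn_singleton, planarLists_singleton, degreeIn_univ] using h

end Growth

/-! ### Pairs of vertices separated by an edge -/

section CyclicSublist

variable {α : Type*} {a : α} {l l' m L L' : List α}

/-- `L` is a sublist of some rotation of `l`: the entries of `L` occur in this cyclic order
in `l`. -/
def CyclicSublist (L l : List α) : Prop :=
  ∃ l', l ~r l' ∧ L.Sublist l'

theorem CyclicSublist.isRotated (h : CyclicSublist L l) (hl : l ~r l') : CyclicSublist L l' :=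
  let ⟨l₁, hl₁, hL⟩ := h
  ⟨l₁, hl.symm.trans hl₁, hL⟩

theorem CyclicSublist.isRotated_sublist (h : CyclicSublist L l) (hL : L ~r L') :
    CyclicSublist L' l := by
  obtain ⟨l', hl', hsub⟩ := h
  obtain ⟨k, hk, rfl⟩ := List.isRotated_iff_mod.1 hL
  rw [← List.take_append_drop k L] at hsub
  obtain ⟨x, y, rfl, hx, hy⟩ := List.append_sublist_iff.1 hsub
  rw [List.rotate_eq_drop_append_take hk]
  exact ⟨y ++ x, hl'.trans List.isRotated_append, hy.append hx⟩

theorem sublist_of_cons_sublist_append_cons {x y : List α}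
    (h : (a :: L).Sublist (x ++ a :: y)) (hx : a ∉ x) : L.Sublist y := by
  induction x with
  | nil => exact List.cons_sublist_cons.1 h
  | cons b x ih =>
    rw [List.mem_cons, not_or] at hx
    cases h with
    | cons _ h => exact ih h hx.2
    | cons_cons _ h => exact absurd rfl hx.1

theorem cyclicSublist_cons_iff (hn : (a :: m).Nodup) :
    CyclicSublist (a :: L) (a :: m) ↔ (a :: L).Sublist (a :: m) := by
  refine ⟨?_, fun h => ⟨_, .refl _, h⟩⟩
  rintro ⟨l, hl, hsub⟩
  obtain ⟨k, hk, rfl⟩ := List.isRotated_iff_mod.1 hl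
  rw [List.rotate_eq_drop_append_take hk] at hsub
  rcases k with _ | k
  · simpa using hsub
  · rw [List.drop_succ_cons, List.take_succ_cons] at hsub
    have := sublist_of_cons_sublist_append_cons hsub
      fun h => (List.nodup_cons.1 hn).1 (List.mem_of_mem_drop h)
    exact (this.trans (List.take_sublist k m)).cons_cons a

theorem isRotated_filter (p : α → Bool) (h : l ~r l') : l.filter p ~r l'.filter p := by
  obtain ⟨k, hk, rfl⟩ := List.isRotated_iff_mod.1 h
  rw [List.rotate_eq_drop_append_take hk, List.filter_append]
  nth_rewrite 1 [← List.take_append_drop k l]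
  rw [List.filter_append]
  exact List.isRotated_append

theorem cyclicSublist_filter_ne_iff [DecidableEq α] (ha : a ∉ L) :
    CyclicSublist L (l.filter (· ≠ a)) ↔ CyclicSublist L l := by
  constructor
  · rintro ⟨l', hl', hL⟩
    obtain ⟨k, hk, rfl⟩ := List.isRotated_iff_mod.1 hl'
    rw [List.rotate_eq_drop_append_take hk] at hL
    obtain ⟨x, y, rfl, hx, hy⟩ :=
      List.filter_eq_append_iff.1 (List.take_append_drop k (l.filter (· ≠ a))).symm
    refine ⟨y ++ x, List.isRotated_append, hL.trans ?_⟩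
    rw [← hx, ← hy]
    exact List.filter_sublist.append List.filter_sublist
  · rintro ⟨l', hl', hL⟩
    have hfilter : L.filter (· ≠ a) = L :=
      List.filter_eq_self.2 fun b hb => decide_eq_true fun h => ha (h ▸ hb)
    exact ⟨_, isRotated_filter _ hl', hfilter ▸ hL.filter _⟩

end CyclicSublist

section Pair

variable {V : Type*} [DecidableEq V] {T : SimpleGraph V} {u v : V}

theorem connectedSet_pair (huv : T.Adj u v) : ConnectedSet T {u, v} := by
  rw [Finset.pair_comm]
  exact (connectedSet_singleton u).insert_of_adj (Finset.mem_singleton_self u) huv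

variable [DecidableRel T.Adj]

theorem degreeIn_pair (huv : T.Adj u v) {p : V} (hp : p ∈ ({u, v} : Finset V)) :
    degreeIn T {u, v} p = 1 := by
  rcases Finset.mem_insert.1 hp with rfl | hp
  · simp [degreeIn, Finset.filter_insert, Finset.filter_singleton, huv]
  · rw [Finset.mem_singleton.1 hp]
    simp [degreeIn, Finset.filter_insert, Finset.filter_singleton, huv.symm]

/-- The degrees are `3, 1, 1, 1` if `p = p'`, and `2, 2, 1, 1` otherwise. -/
theorem prod_degreeIn_insert_insert_pair (hT : T.IsAcyclic) {h h' p p' : V} (huv : T.Adj u v)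
    (hp : p ∈ ({u, v} : Finset V)) (hp' : p' ∈ ({u, v} : Finset V)) (hph : T.Adj p h)
    (hph' : T.Adj p' h') (hh : h ∉ ({u, v} : Finset V))
    (hh' : h' ∉ insert h ({u, v} : Finset V)) :
    ∏ x ∈ insert h' (insert h ({u, v} : Finset V)),
      (degreeIn T (insert h' (insert h {u, v})) x)! = if p = p' then 6 else 4 := by
  have hconn := connectedSet_pair huv
  have hp'_mem : p' ∈ insert h ({u, v} : Finset V) := Finset.mem_insert_of_mem hp'
  rw [prod_degreeIn_insert hp'_mem hh' hph'
    fun q hq => (hconn.insert_of_adj hp hph).eq_of_adj hT hp'_mem hq hh' hph',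
    prod_degreeIn_insert hp hh hph fun q hq => hconn.eq_of_adj hT hp hq hh hph,
    degreeIn_insert hh, degreeIn_pair huv hp, degreeIn_pair huv hp', Finset.prod_pair huv.ne,
    degreeIn_pair huv (p := u) (by simp), degreeIn_pair huv (p := v) (by simp)]
  by_cases hpp : p = p'
  · rw [if_pos hpp, if_pos (hpp ▸ hph)]
    rfl
  · rw [if_neg hpp, if_neg fun hadj => hpp (hconn.eq_of_adj hT hp' hp hh hadj hph)]
    rfl

end Pair

section Separation

variable {V : Type*} [DecidableEq V] {T : SimpleGraph V} {S : Finset V} {u v w w' : V}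

theorem cyclicSublist_iff_of_mem_planarLists {L l : List V}
    (hl : l ∈ planarLists T S u) : CyclicSublist (u :: L) l ↔ (u :: L).Sublist l := by
  obtain ⟨m, rfl⟩ := exists_cons_of_mem_planarLists hl
  exact cyclicSublist_cons_iff (cons_mem_planarLists.1 hl).1

theorem eq_of_sublist_of_mem_planarLists {L l : List V} {r r' : V}
    (hL : L ∈ planarLists T S r) (hl : l ∈ planarLists T S r') (h : L.Sublist l) : L = l := by
  rw [mem_planarLists] at hL hl
  exact h.eq_of_length ((List.perm_ext_iff_of_nodup hL.1 hl.1).2 fun x => by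
    rw [hL.2.1, hl.2.1]).length_eq

variable [Fintype V]

theorem mem_planarLists_univ {r : V} {l : List V} :
    l ∈ planarLists T Finset.univ r ↔
      l.Nodup ∧ (∀ x, x ∈ l) ∧ Noncrossing T l ∧ l.head? = some r := by
  simp [mem_planarLists]

open scoped Classical in
/-- Among the planar arrangements with a given first vertex, each noncrossing arrangement of a
subtree is induced equally often. -/
theorem prod_degreeIn_mul_card_filter_sublist [DecidableRel T.Adj] (hT : T.IsTree)
    (hS : ConnectedSet T S) {L : List V} (hL : u :: L ∈ planarLists T S u) :
    (∏ x ∈ S, (degreeIn T S x)!) *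
        {l ∈ planarLists T Finset.univ u | (u :: L).Sublist l}.card =
      ∏ x, (T.degree x)! := by
  have hmem := (cons_mem_planarLists.1 hL).2.1
  have hu : u ∈ S := (hmem u).1 (by simp)
  let g : List V → ℕ := fun l => if CyclicSublist (u :: L) l then 1 else 0
  have hrot : ∀ l l', l ~r l' → g l = g l' := fun l l' hl =>
    if_congr ⟨fun h => h.isRotated hl, fun h => h.isRotated hl.symm⟩ rfl rfl
  have hfilter : ∀ a ∉ S, ∀ l : List V, g (l.filter (· ≠ a)) = g l := fun a ha l =>
    if_congr (cyclicSublist_filter_ne_iff fun h => ha ((hmem a).1 h)) rfl rfl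
  have hsum : ∀ R : Finset V, ∑ l ∈ planarLists T R u, g l =
      {l ∈ planarLists T R u | (u :: L).Sublist l}.card := by
    intro R
    rw [Finset.card_filter]
    exact Finset.sum_congr rfl fun l hl =>
      if_congr (cyclicSublist_iff_of_mem_planarLists hl) rfl rfl
  have honly : {l ∈ planarLists T S u | (u :: L).Sublist l} = {u :: L} := by
    ext l
    rw [Finset.mem_filter, Finset.mem_singleton]
    refine ⟨fun h => (eq_of_sublist_of_mem_planarLists hL h.1 h.2).symm, ?_⟩
    rintro rfl
    exact ⟨hL, .refl _⟩
  have hgrow : Grows T S Finset.univ :=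
    Grows.refl.univ_of_nonempty hT.1.preconnected ⟨u, hu⟩
  have key := (hgrow.sum_planarLists hT hS g hrot hfilter).2.2 u hu u (by simp)
  rw [hsum, hsum, honly, Finset.card_singleton, mul_one] at key
  simpa only [degreeIn_univ] using key

open scoped Classical in
/-- The number of planar arrangements starting with `u` in which the edge `uv` separates `w`
from `w'`, the former being between `u` and `v`. -/
noncomputable def separations (T : SimpleGraph V) (u v w w' : V) : ℕ :=
  {l ∈ planarLists T Finset.univ u | [u, w, v, w'].Sublist l}.card

theorem separations_eq_zero (h : ¬ [u, w, v, w'].Nodup) : separations T u v w w' = 0 := by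
  rw [separations, Finset.card_eq_zero, Finset.filter_eq_empty_iff]
  exact fun l hl hsub => h ((mem_planarLists.1 hl).1.sublist hsub)

theorem separations_swap (T : SimpleGraph V) (u v w w' : V) :
    separations T u v w w' = separations T v u w' w := by
  classical
  have hrotated : [u, w, v, w'] ~r [v, w', u, w] := ⟨2, rfl⟩
  rw [separations, separations, Finset.card_filter, Finset.card_filter]
  calc ∑ l ∈ planarLists T Finset.univ u, (if [u, w, v, w'].Sublist l then 1 else 0)
      = ∑ l ∈ planarLists T Finset.univ u, (if CyclicSublist [u, w, v, w'] l then 1 else 0) :=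
        Finset.sum_congr rfl fun l hl =>
          if_congr (cyclicSublist_iff_of_mem_planarLists hl).symm rfl rfl
    _ = ∑ l ∈ planarLists T Finset.univ v, (if CyclicSublist [u, w, v, w'] l then 1 else 0) :=
        sum_planarLists_eq_of_isRotated (by simp) (by simp) _ fun l l' hl =>
          if_congr ⟨fun h => h.isRotated hl, fun h => h.isRotated hl.symm⟩ rfl rfl
    _ = ∑ l ∈ planarLists T Finset.univ v, (if [v, w', u, w].Sublist l then 1 else 0) :=
        Finset.sum_congr rfl fun l hl => if_congr
          (Iff.trans ⟨fun h => h.isRotated_sublist hrotated,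
            fun h => h.isRotated_sublist hrotated.symm⟩
            (cyclicSublist_iff_of_mem_planarLists hl)) rfl rfl

theorem sublist_iff_idxOf_lt {l : List V} (hl : l ∈ planarLists T Finset.univ u) :
    [u, w, v, w'].Sublist l ↔
      (l.idxOf u < l.idxOf w ∧ l.idxOf w < l.idxOf v) ∧ l.idxOf v < l.idxOf w' := by
  obtain ⟨hn, hm, -⟩ := mem_planarLists_univ.1 hl
  rw [sublist_iff_forall_mem_and_pairwise (pairwise_idxOf_lt hn)]
  simp only [List.pairwise_cons, List.mem_cons, List.not_mem_nil, or_false, forall_eq_or_imp,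
    forall_eq, hm, true_and, implies_true, false_implies, and_true, List.Pairwise.nil]
  omega

/-- The edge `uv` does not cross the walks from `h` to `w` and from `h'` to `w'`. -/
theorem separations_congr {h h' : V} (huv : T.Adj u v)
    (hw : ReachableWithin T (fun x => x ≠ u ∧ x ≠ v) h w) (hh' : h' ≠ u ∧ h' ≠ v)
    (hw' : ReachableWithin T (fun x => x ≠ u ∧ x ≠ v) h' w') :
    separations T u v w w' = separations T u v h h' := by
  rw [separations, separations]
  congr 1
  refine Finset.filter_congr fun l hl => ?_
  obtain ⟨hn, hm, hc, -⟩ := mem_planarLists_univ.1 hl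
  obtain ⟨m, rfl⟩ := exists_cons_of_mem_planarLists hl
  have between {a b : V} (hab : ReachableWithin T (fun x => x ≠ u ∧ x ≠ v) a b) :=
    hc.idxOf_between_of_reachableWithin hn huv (hm u) (hm v) (hab.mono fun x hx => ⟨hm x, hx⟩)
  have after_iff {x : V} (hx : x ≠ u ∧ x ≠ v) : (u :: m).idxOf v < (u :: m).idxOf x ↔
      ¬ ((u :: m).idxOf u < (u :: m).idxOf x ∧ (u :: m).idxOf x < (u :: m).idxOf v) := by
    have hxu : (u :: m).idxOf x ≠ (u :: m).idxOf u := fun h => hx.1 ((List.idxOf_inj (hm x)).1 h)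
    have hxv : (u :: m).idxOf x ≠ (u :: m).idxOf v := fun h => hx.2 ((List.idxOf_inj (hm x)).1 h)
    have := List.idxOf_cons_self (a := u) (l := m)
    omega
  rw [sublist_iff_idxOf_lt hl, sublist_iff_idxOf_lt hl, after_iff (hw'.prop_right hh'),
    after_iff hh']
  exact and_congr ⟨between hw.symm, between hw⟩ (not_congr ⟨between hw'.symm, between hw'⟩)

variable [DecidableRel T.Adj]

theorem mul_separations_of_adj (hT : T.IsTree) {h h' p p' : V} (huv : T.Adj u v)
    (hp : p ∈ ({u, v} : Finset V)) (hp' : p' ∈ ({u, v} : Finset V)) (hph : T.Adj p h)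
    (hph' : T.Adj p' h') (hh : h ∉ ({u, v} : Finset V)) (hh' : h' ∉ ({u, v} : Finset V))
    (hne : h ≠ h') :
    (if p = p' then 6 else 4) * separations T u v h h' = ∏ x, (T.degree x)! := by
  have hconn := (connectedSet_pair huv).insert_of_adj hp hph
  have hh'_notMem : h' ∉ insert h ({u, v} : Finset V) := by simp_all [Ne.symm hne]
  have hp'_mem : p' ∈ insert h ({u, v} : Finset V) := Finset.mem_insert_of_mem hp'
  rw [← prod_degreeIn_insert_insert_pair hT.2 huv hp hp' hph hph' hh hh'_notMem, separations]
  refine prod_degreeIn_mul_card_filter_sublist hT (hconn.insert_of_adj hp'_mem hph')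
    (cons_mem_planarLists.2 ⟨?_, ?_, ?_⟩)
  · have := huv.ne
    simp_all [eq_comm]
  · intro x
    simp only [Finset.mem_insert, Finset.mem_singleton, List.mem_cons, List.not_mem_nil, or_false]
    tauto
  · intro s a t b _ hab hsub
    obtain ⟨-, rfl, -, rfl⟩ : s = u ∧ a = h ∧ t = v ∧ b = h' := by
      simpa using hsub.eq_of_length_le le_rfl
    exact hh (hconn.eq_of_adj hT.2 hp'_mem (Finset.mem_insert_self _ _) hh'_notMem hph' hab ▸ hp')

end Separation

section SideSums

variable {V : Type*} [Fintype V] [DecidableEq V] {T : SimpleGraph V} {u v : V}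

theorem mem_erase_side (hT : T.IsTree) (huv : T.Adj u v) {w : V} :
    w ∈ (side T v u).erase u ↔ w ≠ u ∧ branch T u w ≠ v := by
  rw [← compl_side hT huv, Finset.mem_erase, Finset.mem_compl, mem_side]
  tauto

theorem card_erase_side (hT : T.IsTree) (huv : T.Adj u v) :
    (((side T v u).erase u).card : ℤ) = (side T v u).card - 1 := by
  rw [Finset.cast_card_erase_of_mem (mem_side_self hT.2 huv.symm)]

theorem sum_eq_sum_erase_side_add (hT : T.IsTree) (huv : T.Adj u v) {M : Type*} [AddCommMonoid M]
    (f : V → M) (hu : f u = 0) (hv : f v = 0) :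
    ∑ w, f w = ∑ w ∈ (side T v u).erase u, f w + ∑ w ∈ (side T u v).erase v, f w := by
  rw [Finset.sum_erase _ hu, Finset.sum_erase _ hv, ← compl_side hT huv, add_comm,
    Finset.sum_add_sum_compl]

theorem reachableWithin_branch_of_mem_erase_side (hT : T.IsTree) (huv : T.Adj u v) {w : V}
    (hw : w ∈ (side T v u).erase u) : T.Adj u (branch T u w) ∧
      (branch T u w ≠ u ∧ branch T u w ≠ v) ∧
      ReachableWithin T (fun x => x ≠ u ∧ x ≠ v) (branch T u w) w := by
  obtain ⟨hwu, hbr⟩ := (mem_erase_side hT huv).1 hw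
  have hadj := adj_branch hT.1.preconnected hwu
  exact ⟨hadj, ⟨hadj.ne', hbr⟩,
    ReachableWithin.and_ne_of_adj hT.2 hadj huv hbr
      (reachableWithin_branch hT.1.preconnected hwu)⟩

theorem card_filter_idxOf {l : List V} (hn : l.Nodup) (hm : ∀ x, x ∈ l) (P : ℕ → Prop)
    [DecidablePred P] :
    ({x | P (l.idxOf x)} : Finset V).card = {i ∈ Finset.range (Fintype.card V) | P i}.card := by
  have hinj : Function.Injective fun x => l.idxOf x := fun x _ h => (List.idxOf_inj (hm x)).1 h
  have himage : Finset.univ.image (fun x => l.idxOf x) = Finset.range (Fintype.card V) := by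
    refine Finset.eq_of_subset_of_card_le (Finset.image_subset_iff.2 fun x _ => ?_) ?_
    · exact Finset.mem_range.2 (length_eq_card hn hm ▸ List.idxOf_lt_length_iff.2 (hm x))
    · rw [Finset.card_range, Finset.card_image_of_injective _ hinj, Finset.card_univ]
  rw [← himage, Finset.filter_image, Finset.card_image_of_injective _ hinj]

theorem idxOf_sub_one_mul_eq_sum_sublist {l : List V} (huv : u ≠ v)
    (hl : l ∈ planarLists T Finset.univ u) :
    ((l.idxOf v : ℤ) - 1) * (Fintype.card V - 1 - l.idxOf v) =
      ∑ w, ∑ w', if [u, w, v, w'].Sublist l then (1 : ℤ) else 0 := by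
  obtain ⟨hn, hm, -⟩ := mem_planarLists_univ.1 hl
  have hu : l.idxOf u = 0 := by
    obtain ⟨m, rfl⟩ := exists_cons_of_mem_planarLists hl
    exact List.idxOf_cons_self
  have hv : l.idxOf v ≠ 0 := fun h => huv ((List.idxOf_inj (hm u)).1 (hu.trans h.symm))
  have hlt : l.idxOf v < Fintype.card V :=
    (List.idxOf_lt_length_iff.2 (hm v)).trans_le hn.length_le_card
  have hbefore : ({w | l.idxOf u < l.idxOf w ∧ l.idxOf w < l.idxOf v} : Finset V).card =
      l.idxOf v - 1 := by
    rw [card_filter_idxOf hn hm fun i => l.idxOf u < i ∧ i < l.idxOf v, hu,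
      ← Nat.sub_zero (l.idxOf v), ← Nat.card_Ioo]
    congr 1
    grind
  have hafter : ({w | l.idxOf v < l.idxOf w} : Finset V).card =
      Fintype.card V - l.idxOf v - 1 := by
    rw [card_filter_idxOf hn hm fun i => l.idxOf v < i, ← Nat.card_Ioo]
    congr 1
    grind
  have hboole (w w' : V) : (if [u, w, v, w'].Sublist l then (1 : ℤ) else 0) =
      (if l.idxOf u < l.idxOf w ∧ l.idxOf w < l.idxOf v then 1 else 0) *
        if l.idxOf v < l.idxOf w' then 1 else 0 := by
    rw [ite_zero_mul_ite_zero, mul_one, if_congr (sublist_iff_idxOf_lt hl) rfl rfl]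
  simp only [hboole, ← Finset.mul_sum, ← Finset.sum_mul, Finset.sum_boole, hbefore, hafter]
  congr 1 <;> omega

variable [DecidableRel T.Adj]

/-- The sum of the squares of the sizes of the branches at `u` other than that of `v`. -/
noncomputable def otherSquares (T : SimpleGraph V) [DecidableRel T.Adj] (u v : V) : ℤ :=
  ∑ c ∈ (T.neighborFinset u).erase v, ((side T u c).card : ℤ) ^ 2

theorem sum_branch_eq_branch (hT : T.IsTree) (huv : T.Adj u v) :
    ∑ w ∈ (side T v u).erase u, ∑ w' ∈ (side T v u).erase u,
      (if branch T u w = branch T u w' then (1 : ℤ) else 0) = otherSquares T u v := by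
  have hmaps : ∀ w ∈ (side T v u).erase u, branch T u w ∈ (T.neighborFinset u).erase v := by
    intro w hw
    obtain ⟨hadj, ⟨-, hne⟩, -⟩ := reachableWithin_branch_of_mem_erase_side hT huv hw
    exact Finset.mem_erase.2 ⟨hne, (T.mem_neighborFinset u _).2 hadj⟩
  have hfiber : ∀ c ∈ (T.neighborFinset u).erase v,
      {w ∈ (side T v u).erase u | branch T u w = c} = side T u c := by
    intro c hc
    have hcv := Finset.ne_of_mem_erase hc
    ext w
    rw [Finset.mem_filter, mem_erase_side hT huv, mem_side]
    grind
  rw [← Finset.sum_fiberwise_of_maps_to hmaps, otherSquares]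
  refine Finset.sum_congr rfl fun c hc => ?_
  rw [Finset.sum_congr rfl fun w hw => by rw [(Finset.mem_filter.1 hw).2], Finset.sum_const,
    Finset.sum_boole, Finset.filter_congr fun x _ => eq_comm (a := c), hfiber c hc, nsmul_eq_mul,
    sq]

theorem six_mul_separations_of_mem_erase_side (hT : T.IsTree) (huv : T.Adj u v) {w w' : V}
    (hw : w ∈ (side T v u).erase u) (hw' : w' ∈ (side T v u).erase u) :
    (6 * separations T u v w w' : ℤ) =
      (∏ x, ((T.degree x)! : ℤ)) * (1 - if branch T u w = branch T u w' then 1 else 0) := by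
  obtain ⟨hadj, hne, hreach⟩ := reachableWithin_branch_of_mem_erase_side hT huv hw
  obtain ⟨hadj', hne', hreach'⟩ := reachableWithin_branch_of_mem_erase_side hT huv hw'
  rw [separations_congr huv hreach hne' hreach']
  split_ifs with hbranch
  · rw [separations_eq_zero (by simp [hbranch]), Nat.cast_zero, mul_zero, sub_self, mul_zero]
  · rw [sub_zero, mul_one]
    exact_mod_cast (if_pos rfl ▸ mul_separations_of_adj hT huv (p := u) (p' := u) (by simp)
      (by simp) hadj hadj' (by simpa using hne) (by simpa using hne') hbranch)

theorem four_mul_separations_of_mem_erase_side (hT : T.IsTree) (huv : T.Adj u v) {w w' : V}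
    (hw : w ∈ (side T v u).erase u) (hw' : w' ∈ (side T u v).erase v) :
    (4 * separations T u v w w' : ℤ) = ∏ x, ((T.degree x)! : ℤ) ∧
      (4 * separations T u v w' w : ℤ) = ∏ x, ((T.degree x)! : ℤ) := by
  obtain ⟨hadj, hne, hreach⟩ := reachableWithin_branch_of_mem_erase_side hT huv hw
  obtain ⟨hadj', hne', hreach'⟩ := reachableWithin_branch_of_mem_erase_side hT huv.symm hw'
  replace hreach' := hreach'.mono (Q := fun x => x ≠ u ∧ x ≠ v) fun _ => And.symm
  have hbranch : branch T u w ≠ branch T v w' := fun h => huv.ne <|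
    ReachableWithin.eq_of_adj_of_adj hT.2 hadj.symm (h ▸ hadj'.symm)
      (.of_adj huv hadj.ne (h ▸ hadj'.ne))
  rw [separations_congr huv hreach hne'.symm hreach', separations_congr huv hreach' hne hreach]
  have hmem : branch T u w ∉ ({u, v} : Finset V) := by simpa using hne
  have hmem' : branch T v w' ∉ ({u, v} : Finset V) := by simpa [and_comm] using hne'
  constructor
  · exact_mod_cast (if_neg huv.ne ▸ mul_separations_of_adj hT huv (p := u) (p' := v) (by simp)
      (by simp) hadj hadj' hmem hmem' hbranch)
  · exact_mod_cast (if_neg huv.ne' ▸ mul_separations_of_adj hT huv (p := v) (p' := u) (by simp)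
      (by simp) hadj' hadj hmem' hmem hbranch.symm)

theorem sum_separations_same_side (hT : T.IsTree) (huv : T.Adj u v) :
    6 * ∑ w ∈ (side T v u).erase u, ∑ w' ∈ (side T v u).erase u, (separations T u v w w' : ℤ) =
      (∏ x, ((T.degree x)! : ℤ)) * (((side T v u).card - 1) ^ 2 - otherSquares T u v) := by
  simp only [Finset.mul_sum]
  rw [Finset.sum_congr rfl fun w hw => Finset.sum_congr rfl fun w' hw' =>
    six_mul_separations_of_mem_erase_side hT huv hw hw']
  simp only [← Finset.mul_sum, Finset.sum_sub_distrib, Finset.sum_const, nsmul_eq_mul, mul_one,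
    sum_branch_eq_branch hT huv, card_erase_side hT huv]
  ring

theorem sum_separations_opposite_sides (hT : T.IsTree) (huv : T.Adj u v) :
    2 * (∑ w ∈ (side T v u).erase u, ∑ w' ∈ (side T u v).erase v, (separations T u v w w' : ℤ) +
      ∑ w ∈ (side T u v).erase v, ∑ w' ∈ (side T v u).erase u, (separations T u v w w' : ℤ)) =
      (∏ x, ((T.degree x)! : ℤ)) * (((side T v u).card - 1) * ((side T u v).card - 1)) := by
  refine mul_left_cancel₀ (two_ne_zero' ℤ) ?_
  rw [Finset.sum_comm (s := (side T u v).erase v), ← Finset.sum_add_distrib]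
  simp only [← Finset.sum_add_distrib, Finset.mul_sum]
  rw [Finset.sum_congr rfl fun w hw => Finset.sum_congr rfl fun w' hw' =>
    show _ = 2 * ∏ x, ((T.degree x)! : ℤ) by
      obtain ⟨h, h'⟩ := four_mul_separations_of_mem_erase_side hT huv hw hw'
      linear_combination h + h']
  simp only [Finset.sum_const, nsmul_eq_mul, card_erase_side hT huv, card_erase_side hT huv.symm]
  ring

theorem sum_separations (hT : T.IsTree) (huv : T.Adj u v) :
    6 * ∑ w, ∑ w', (separations T u v w w' : ℤ) = (∏ x, ((T.degree x)! : ℤ)) *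
      (((side T v u).card - 1) ^ 2 + ((side T u v).card - 1) ^ 2 +
        3 * ((side T v u).card - 1) * ((side T u v).card - 1) -
        otherSquares T u v - otherSquares T v u) := by
  have hzero (w w' : V) (h : ¬ [u, w, v, w'].Nodup) : (separations T u v w w' : ℤ) = 0 := by
    rw [separations_eq_zero h, Nat.cast_zero]
  have hsplit (w : V) := sum_eq_sum_erase_side_add hT huv
    (fun w' => (separations T u v w w' : ℤ)) (hzero w u (by simp)) (hzero w v (by simp))
  rw [sum_eq_sum_erase_side_add hT huv _ (Finset.sum_eq_zero fun w' _ => hzero _ _ (by simp))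
    (Finset.sum_eq_zero fun w' _ => hzero _ _ (by simp))]
  simp only [hsplit, Finset.sum_add_distrib]
  have hsame := sum_separations_same_side hT huv.symm
  simp only [separations_swap T v u] at hsame
  rw [Finset.sum_comm] at hsame
  linear_combination sum_separations_same_side hT huv + hsame +
    3 * sum_separations_opposite_sides hT huv

/-- With `i` the index of `v`, the product `(i - 1) * (n - 1 - i)` counts the pairs of vertices
separated by `u` and `v`, which turns the sum into one of `separations`. -/
theorem sum_planarLists_gap (hT : T.IsTree) (huv : T.Adj u v) :
    6 * ∑ l ∈ planarLists T Finset.univ u,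
      (l.idxOf v : ℤ) * ((Fintype.card V : ℤ) - l.idxOf v) =
    (∏ x, ((T.degree x)! : ℤ)) * ((Fintype.card V : ℤ) ^ 2 + Fintype.card V - 1 +
      (side T u v).card * (side T v u).card - otherSquares T u v - otherSquares T v u) := by
  classical
  have hgap : ∀ l ∈ planarLists T Finset.univ u,
      (l.idxOf v : ℤ) * ((Fintype.card V : ℤ) - l.idxOf v) =
        (Fintype.card V - 1) + ∑ w, ∑ w', if [u, w, v, w'].Sublist l then (1 : ℤ) else 0 := by
    intro l hl
    rw [← idxOf_sub_one_mul_eq_sum_sublist huv.ne hl]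
    ring
  have hcount : ∑ l ∈ planarLists T Finset.univ u, ∑ w, ∑ w',
      (if [u, w, v, w'].Sublist l then (1 : ℤ) else 0) =
      ∑ w, ∑ w', (separations T u v w w' : ℤ) := by
    rw [Finset.sum_comm]
    refine Finset.sum_congr rfl fun w _ => ?_
    rw [Finset.sum_comm]
    refine Finset.sum_congr rfl fun w' _ => ?_
    rw [Finset.sum_boole, separations]
  have hcard : ((side T u v).card : ℤ) + (side T v u).card = Fintype.card V := by
    exact_mod_cast card_side_add_card_side hT huv
  rw [Finset.sum_congr rfl hgap, Finset.sum_add_distrib, hcount, Finset.sum_const,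
    card_planarLists_univ hT, mul_add, sum_separations hT huv, nsmul_eq_mul, Nat.cast_prod, ← hcard]
  ring

end SideSums

section Rotation

variable {α : Type*} [DecidableEq α] {l m : List α} {u v x : α}

theorem idxOf_rotate_eq (hn : l.Nodup) {i j : ℕ} (hj : j < l.length)
    (h : (j + i) % l.length = l.idxOf x) : (l.rotate i).idxOf x = j := by
  have hj' : j < (l.rotate i).length := by rwa [List.length_rotate]
  have hidx := (List.nodup_rotate.2 hn : (l.rotate i).Nodup).idxOf_getElem j hj'
  simpa only [List.getElem_rotate, h, List.getElem_idxOf] using hidx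

/-- Of the rotations by `i < l.length`, those with `1 ≤ i ≤ l.idxOf v` put `v` before `u`. -/
theorem sum_rotate_abs_idxOf_sub (hl : l = u :: m) (hn : l.Nodup) (hv : v ∈ l) :
    ∑ i ∈ Finset.range l.length, |((l.rotate i).idxOf u : ℤ) - (l.rotate i).idxOf v| =
      2 * ((l.idxOf v : ℤ) * (l.length - l.idxOf v)) := by
  have hidx : l.idxOf u = 0 := by simp [hl]
  have hlt := List.idxOf_lt_length_iff.2 hv
  set k := l.idxOf v with hk
  have hterm : ∀ i ∈ Finset.range l.length,
      |((l.rotate i).idxOf u : ℤ) - (l.rotate i).idxOf v| =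
        (k : ℤ) + if 0 < i ∧ i ≤ k then (l.length : ℤ) - 2 * k else 0 := by
    intro i hi
    rw [Finset.mem_range] at hi
    rcases Nat.eq_zero_or_pos i with rfl | hpos
    · simp [hidx, hk]
    rw [idxOf_rotate_eq hn (j := l.length - i) (by omega)
      (by rw [hidx, Nat.sub_add_cancel hi.le, Nat.mod_self])]
    by_cases hik : i ≤ k
    · rw [idxOf_rotate_eq hn (j := k - i) (by omega)
        (by rw [Nat.sub_add_cancel hik, Nat.mod_eq_of_lt hlt]), if_pos ⟨hpos, hik⟩,
        abs_of_nonneg (by omega)]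
      omega
    · rw [idxOf_rotate_eq hn (j := l.length + k - i) (by omega)
        (by rw [Nat.sub_add_cancel (by omega), Nat.add_mod_left, Nat.mod_eq_of_lt hlt]),
        if_neg (by omega), abs_of_nonpos (by omega)]
      omega
  have hfilter : {i ∈ Finset.range l.length | 0 < i ∧ i ≤ k} = Finset.Ioc 0 k := by grind
  rw [Finset.sum_congr rfl hterm, Finset.sum_add_distrib, ← Finset.sum_filter, hfilter,
    Finset.sum_const, Finset.sum_const, Finset.card_range, Nat.card_Ioc, Nat.sub_zero, nsmul_eq_mul,
    nsmul_eq_mul]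
  ring

end Rotation

section Arrangements

/-! ### Arrangements as lists -/

variable {V : Type*} [Fintype V]

/-- The vertices in the order of the arrangement. -/
def Arrangement.toList (π : Arrangement V) : List V :=
  (List.finRange (Fintype.card V)).map π.symm

theorem Arrangement.nodup_toList (π : Arrangement V) : π.toList.Nodup :=
  (List.nodup_finRange _).map π.symm.injective

theorem Arrangement.mem_toList (π : Arrangement V) (x : V) : x ∈ π.toList :=
  List.mem_map.2 ⟨π x, List.mem_finRange _, π.symm_apply_apply x⟩

theorem Arrangement.idxOf_toList [DecidableEq V] (π : Arrangement V) (x : V) :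
    π.toList.idxOf x = π x := by
  have hlt : (π x : ℕ) < π.toList.length := by simp [Arrangement.toList]
  have hget : π.toList[(π x : ℕ)] = x := by simp [Arrangement.toList]
  rw [← π.nodup_toList.idxOf_getElem _ hlt, hget]

theorem Arrangement.pairwise_toList (π : Arrangement V) :
    π.toList.Pairwise fun a b => (π a : ℕ) < π b := by
  classical
  simpa only [π.idxOf_toList] using pairwise_idxOf_lt π.nodup_toList

theorem mem_planarArrangements {T : SimpleGraph V} {π : Arrangement V} :
    π ∈ planarArrangements T ↔ Noncrossing T π.toList := by
  rw [planarArrangements, Set.mem_ofPred_eq, crossings, Set.ncard_eq_zero (Set.toFinite _),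
    Set.eq_empty_iff_forall_notMem]
  constructor
  · intro h s u t v hst huv hsub
    have hlt := ((sublist_iff_forall_mem_and_pairwise π.pairwise_toList _).1 hsub).2
    simp only [List.pairwise_cons, List.mem_cons, List.not_mem_nil, or_false, forall_eq_or_imp,
      forall_eq] at hlt
    exact h ((s, t), (u, v)) ⟨hst, huv, hlt.1.1, hlt.2.1.1, hlt.2.2.1⟩
  · rintro h ⟨⟨s, t⟩, u, v⟩ ⟨hst, huv, hsu, hut, htv⟩
    exact h.not_lt π.pairwise_toList (π.mem_toList _) (π.mem_toList _) (π.mem_toList _)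
      (π.mem_toList _) hst huv hsu hut htv

theorem Arrangement.exists_toList_eq {l : List V} (hn : l.Nodup) (hm : ∀ x, x ∈ l) :
    ∃ π : Arrangement V, π.toList = l := by
  classical
  refine ⟨(hn.getEquivOfForallMemList l hm).symm.trans (finCongr (length_eq_card hn hm)), ?_⟩
  refine List.ext_getElem (by simp [Arrangement.toList, length_eq_card hn hm]) fun i _ _ => ?_
  simp [Arrangement.toList]

theorem Arrangement.toList_injective :
    Function.Injective (Arrangement.toList : Arrangement V → List V) := by
  classical
  intro π π' h
  refine Equiv.ext fun x => Fin.ext ?_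
  rw [← π.idxOf_toList, ← π'.idxOf_toList, h]

section RotatedPlanarLists

variable [DecidableEq V] {T : SimpleGraph V}

theorem length_of_mem_planarLists_univ {r : V} {l : List V} (hl : l ∈ planarLists T Finset.univ r) :
    l.length = Fintype.card V :=
  length_eq_card (mem_planarLists_univ.1 hl).1 (mem_planarLists_univ.1 hl).2.1

theorem injOn_rotate (T : SimpleGraph V) (r : V) :
    Set.InjOn (fun q : List V × ℕ => q.1.rotate q.2)
      ↑(planarLists T Finset.univ r ×ˢ Finset.range (Fintype.card V)) := by
  rintro ⟨l, i⟩ hl ⟨l', i'⟩ hl' h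
  obtain ⟨hl, hi⟩ := Finset.mem_product.1 hl
  obtain ⟨hl', hi'⟩ := Finset.mem_product.1 hl'
  obtain rfl : l = l' := eq_of_isRotated_of_mem_planarLists hl hl' <|
    List.IsRotated.trans ⟨i, h⟩ (List.IsRotated.symm ⟨i', rfl⟩)
  have hlength := length_of_mem_planarLists_univ hl
  rcases (mem_planarLists_univ.1 hl).1.rotate_congr_iff.1 h with hmod | rfl
  · rw [hlength, Nat.mod_eq_of_lt (Finset.mem_range.1 hi),
      Nat.mod_eq_of_lt (Finset.mem_range.1 hi')] at hmod
    exact Prod.ext rfl hmod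
  · obtain ⟨m, hm⟩ := exists_cons_of_mem_planarLists hl
    exact absurd hm (List.cons_ne_nil _ _).symm

open scoped Classical in
theorem image_toList_planarArrangements (T : SimpleGraph V) (r : V) :
    (planarArrangements T).toFinset.image Arrangement.toList =
      (planarLists T Finset.univ r ×ˢ Finset.range (Fintype.card V)).image
        fun q => q.1.rotate q.2 := by
  ext l
  simp only [Finset.mem_image, Set.mem_toFinset, Finset.mem_product, Finset.mem_range, Prod.exists]
  constructor
  · rintro ⟨π, hπ, rfl⟩
    have hplanar : π.toList.rotate (π.toList.idxOf r) ∈ planarLists T Finset.univ r :=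
      mem_planarLists_univ.2 ⟨List.nodup_rotate.2 π.nodup_toList,
        fun x => List.mem_rotate.2 (π.mem_toList x),
        (mem_planarArrangements.1 hπ).isRotated ⟨_, rfl⟩, head?_rotate_idxOf (π.mem_toList r)⟩
    have hrotated : π.toList.rotate (π.toList.idxOf r) ~r π.toList :=
      List.IsRotated.symm ⟨_, rfl⟩
    obtain ⟨i, -, hi⟩ := List.isRotated_iff_mod.1 hrotated
    have hpos : 0 < Fintype.card V := Fintype.card_pos_iff.2 ⟨r⟩
    refine ⟨_, i % Fintype.card V, ⟨hplanar, Nat.mod_lt _ hpos⟩, ?_⟩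
    rw [← length_of_mem_planarLists_univ hplanar, List.rotate_mod, hi]
  · rintro ⟨l, i, ⟨hl, -⟩, rfl⟩
    obtain ⟨hn, hm, hc, -⟩ := mem_planarLists_univ.1 hl
    obtain ⟨π, hπ⟩ := Arrangement.exists_toList_eq (List.nodup_rotate.2 hn)
      fun x => List.mem_rotate.2 (hm x)
    exact ⟨π, mem_planarArrangements.2 (hπ ▸ hc.isRotated ⟨i, rfl⟩), hπ⟩

open scoped Classical in
theorem sum_planarArrangements (T : SimpleGraph V) (r : V) {M : Type*} [AddCommMonoid M]
    (F : List V → M) :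
    ∑ π ∈ (planarArrangements T).toFinset, F (Arrangement.toList π) =
      ∑ l ∈ planarLists T Finset.univ r, ∑ i ∈ Finset.range (Fintype.card V), F (l.rotate i) := by
  rw [← Finset.sum_image (f := F) Arrangement.toList_injective.injOn,
    image_toList_planarArrangements T r, Finset.sum_image (injOn_rotate T r), Finset.sum_product]

end RotatedPlanarLists

theorem numPlanar_eq {T : SimpleGraph V} [DecidableRel T.Adj] (hT : T.IsTree) :
    numPlanar T = Fintype.card V * ∏ x, (T.degree x)! := by
  classical
  obtain ⟨r⟩ := hT.1.nonempty
  have hsum := sum_planarArrangements T r fun _ => 1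
  rw [Finset.sum_const, smul_eq_mul, mul_one] at hsum
  rw [numPlanar, Set.ncard_eq_toFinset_card', hsum, Finset.sum_const, Finset.sum_const,
    Finset.card_range, card_planarLists_univ hT, smul_eq_mul, smul_eq_mul, mul_one, mul_comm]

end Arrangements

section Expectations

/-! ### Probabilities and expectations -/

theorem measureReal_mul_integral_cond {Ω : Type*} [MeasurableSpace Ω] (μ : Measure Ω)
    [IsFiniteMeasure μ] (s : Set Ω) (f : Ω → ℝ) :
    μ.real s * ∫ x, f x ∂μ[|s] = ∫ x in s, f x ∂μ := by
  rcases eq_or_ne (μ s) 0 with h | h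
  · rw [measureReal_def, h, Measure.restrict_eq_zero.2 h, integral_zero_measure,
      ENNReal.toReal_zero, zero_mul]
  · rw [ProbabilityTheory.cond, integral_smul_measure, ENNReal.toReal_inv, ← measureReal_def,
      smul_eq_mul, mul_inv_cancel_left₀ ((measureReal_ne_zero_iff (measure_ne_top μ s)).2 h)]

theorem integral_eq_integral_cond_add_integral_cond_compl {Ω : Type*} [MeasurableSpace Ω]
    {μ : Measure Ω} [IsFiniteMeasure μ] {s : Set Ω} (hs : MeasurableSet s) {f : Ω → ℝ}
    (hf : Integrable f μ) :
    ∫ x, f x ∂μ = (∫ x, f x ∂μ[|s]) * μ.real s + (∫ x, f x ∂μ[|sᶜ]) * μ.real sᶜ := by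
  rw [mul_comm, measureReal_mul_integral_cond, mul_comm, measureReal_mul_integral_cond,
    integral_add_compl hs hf]

section UniformOn

variable {Ω : Type*} [MeasurableSpace Ω] [DiscreteMeasurableSpace Ω]

theorem integral_uniformOn [Finite Ω] (s : Finset Ω) (f : Ω → ℝ) :
    ∫ x, f x ∂(uniformOn (s : Set Ω)) = (∑ x ∈ s, f x) / s.card := by
  have hcount : (Measure.count (s : Set Ω)).toReal = s.card := by
    rw [Measure.count_apply_finset, ENNReal.toReal_natCast]
  rw [uniformOn, ProbabilityTheory.cond, integral_smul_measure,
    setIntegral_finset s Integrable.of_finite.integrableOn, ENNReal.toReal_inv, hcount, smul_eq_mul,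
    inv_mul_eq_div]
  simp only [measureReal_def, Measure.count_singleton, ENNReal.toReal_one, one_smul]

theorem uniformOn_univ_real [Fintype Ω] (s : Set Ω) :
    (uniformOn (Set.univ : Set Ω)).real s = (s.ncard : ℝ) / Fintype.card Ω := by
  rw [measureReal_def, uniformOn_univ, Measure.count_apply_finite _ s.toFinite,
    ← Set.ncard_eq_toFinset_card _ s.toFinite, ENNReal.toReal_div, ENNReal.toReal_natCast,
    ENNReal.toReal_natCast]

end UniformOn

variable {V : Type*} [Fintype V]

theorem card_arrangement [DecidableEq V] : Fintype.card (Arrangement V) = (Fintype.card V)! :=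
  Fintype.card_equiv (Fintype.equivFin V)

instance Arrangement.isProbabilityMeasure_arrangementLaw :
    IsProbabilityMeasure (arrangementLaw V) :=
  have : Nonempty (Arrangement V) := ⟨Fintype.equivFin V⟩
  instIsProbabilityMeasure_uniformOn_univ

theorem setOf_one_le_crossings (T : SimpleGraph V) :
    {π : Arrangement V | 1 ≤ crossings T π} = (planarArrangements T)ᶜ := by
  ext π
  exact Nat.one_le_iff_ne_zero

theorem probNoCrossing_eq (T : SimpleGraph V) :
    probNoCrossing T = (numPlanar T : ℝ) / ((Fintype.card V)! : ℝ) := by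
  classical
  rw [probNoCrossing, arrangementLaw, uniformOn_univ_real, card_arrangement]
  rfl

theorem probCrossing_eq_one_sub (T : SimpleGraph V) : probCrossing T = 1 - probNoCrossing T := by
  rw [probCrossing, setOf_one_le_crossings, probReal_compl_eq_one_sub .of_discrete]
  rfl

theorem probCrossing_eq (T : SimpleGraph V) :
    probCrossing T =
      (((Fintype.card V)! : ℝ) - (numPlanar T : ℝ)) / ((Fintype.card V)! : ℝ) := by
  rw [probCrossing_eq_one_sub, probNoCrossing_eq, sub_div, div_self (by positivity)]

theorem probCrossing_pos {T : SimpleGraph V} (h : ∃ π : Arrangement V, 1 ≤ crossings T π) :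
    0 < probCrossing T := by
  classical
  rw [probCrossing, arrangementLaw, uniformOn_univ_real]
  have : Nonempty (Arrangement V) := ⟨h.choose⟩
  exact div_pos (Nat.cast_pos.2 ((Set.ncard_pos).2 h)) (Nat.cast_pos.2 Fintype.card_pos)

theorem expSumLengthsCrossing_eq {T : SimpleGraph V}
    (h : ∃ π : Arrangement V, 1 ≤ crossings T π) :
    expSumLengthsCrossing T =
      (expSumLengths T - expSumLengthsPlanar T * probNoCrossing T) / probCrossing T := by
  have hcond : (arrangementLaw V)[|planarArrangements T] = uniformOn (planarArrangements T) := by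
    rw [arrangementLaw, uniformOn, cond_cond_eq_cond_inter' .univ .of_discrete
      (measure_ne_top _ _), Set.univ_inter, uniformOn]
  have htotal := integral_eq_integral_cond_add_integral_cond_compl (μ := arrangementLaw V)
    (s := planarArrangements T) .of_discrete (f := sumEdgeLengths T) .of_finite
  rw [hcond, ← setOf_one_le_crossings] at htotal
  rw [eq_div_iff (probCrossing_pos h).ne', eq_sub_iff_add_eq']
  exact htotal.symm

end Expectations

section Totals

/-! ### Expected sums of edge lengths -/

theorem sum_edgeFinset_eq_sum_neighborFinset {V M : Type*} [Fintype V] [AddCommMonoid M]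
    {T : SimpleGraph V} [DecidableRel T.Adj] [Fintype T.edgeSet] {F : Sym2 V → M} {f : V → V → M}
    (h : ∀ u v, T.Adj u v → F s(u, v) = f u v + f v u) :
    ∑ e ∈ T.edgeFinset, F e = ∑ u, ∑ v ∈ T.neighborFinset u, f u v := by
  classical
  have hdarts : ∑ u, ∑ v ∈ T.neighborFinset u, f u v = ∑ d : T.Dart, f d.fst d.snd := by
    rw [Finset.sum_sigma']
    exact Finset.sum_bij' (fun q hq => ⟨(q.1, q.2), by simpa using hq⟩)
      (fun d _ => ⟨d.fst, d.snd⟩) (fun _ _ => Finset.mem_univ _) (fun d _ => by simp [d.adj])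
      (fun _ _ => rfl) (fun _ _ => rfl) (fun _ _ => rfl)
  have hmaps : ∀ d ∈ (Finset.univ : Finset T.Dart), d.edge ∈ T.edgeFinset :=
    fun d _ => SimpleGraph.mem_edgeFinset.2 d.edge_mem
  rw [hdarts, ← Finset.sum_fiberwise_of_maps_to hmaps]
  refine Finset.sum_congr rfl fun e he => ?_
  induction e with | _ u v =>
  have huv : T.Adj u v := SimpleGraph.mem_edgeFinset.1 he
  have hfiber := SimpleGraph.Dart.edge_fiber (G := T) ⟨(u, v), huv⟩
  rw [SimpleGraph.Dart.edge_mk] at hfiber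
  rw [hfiber, Finset.sum_pair (SimpleGraph.Dart.symm_ne _).symm, h u v huv]
  rfl

theorem sum_abs_sub_range (n : ℕ) :
    3 * ∑ i ∈ Finset.range n, ∑ j ∈ Finset.range n, |(i : ℤ) - j| = (n : ℤ) ^ 3 - n := by
  induction n with
  | zero => rfl
  | succ n ih =>
    have hleft : ∑ i ∈ Finset.range n, |(i : ℤ) - n| = ∑ i ∈ Finset.range n, ((n : ℤ) - i) := by
      refine Finset.sum_congr rfl fun i hi => ?_
      rw [Finset.mem_range] at hi
      rw [abs_sub_comm, abs_of_nonneg (by omega)]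
    have hright : ∑ i ∈ Finset.range n, |(n : ℤ) - i| = ∑ i ∈ Finset.range n, ((n : ℤ) - i) := by
      simp only [← hleft, abs_sub_comm]
    have hgauss : 2 * ∑ i ∈ Finset.range n, ((n : ℤ) - i) = (n : ℤ) * (n + 1) := by
      have h : (∑ i ∈ Finset.range (n + 1), (i : ℤ)) * 2 = (n + 1) * n := by
        have := congrArg (Nat.cast (R := ℤ)) (Finset.sum_range_id_mul_two (n + 1))
        rwa [Nat.add_sub_cancel, Nat.cast_mul, Nat.cast_sum, Nat.cast_mul, Nat.cast_succ] at this
      rw [Finset.sum_range_succ] at h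
      rw [Finset.sum_sub_distrib, Finset.sum_const, Finset.card_range, nsmul_eq_mul]
      linear_combination -h
    simp only [Finset.sum_range_succ, Finset.sum_add_distrib, hleft, hright, sub_self, abs_zero,
      add_zero, Nat.cast_add_one]
    linear_combination ih + 3 * hgauss

variable {V : Type*} [Fintype V]

theorem edgeLength_mk (π : Arrangement V) (u v : V) :
    edgeLength π s(u, v) = ((|(π u : ℤ) - π v| : ℤ) : ℝ) := by
  push_cast
  rfl

theorem sumEdgeLengths_eq (T : SimpleGraph V) [Fintype T.edgeSet] (π : Arrangement V) :
    sumEdgeLengths T π = ∑ e ∈ T.edgeFinset, edgeLength π e := by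
  rw [sumEdgeLengths]
  congr!

theorem sum_sum_abs_sub (π : Arrangement V) :
    3 * ∑ x, ∑ y, |(π x : ℤ) - π y| = (Fintype.card V : ℤ) ^ 3 - Fintype.card V := by
  rw [Equiv.sum_comp π fun i => ∑ y, |(i : ℤ) - π y|, ← sum_abs_sub_range, Finset.sum_range]
  congr! 2 with i
  rw [Equiv.sum_comp π fun j => |(i : ℤ) - j|, Finset.sum_range]

theorem sum_arrangement_congr [DecidableEq V] {M : Type*} [AddCommMonoid M]
    (f : Fin (Fintype.card V) → Fin (Fintype.card V) → M) {u v u' v' : V} (h : u ≠ v)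
    (h' : u' ≠ v') :
    ∑ π : Arrangement V, f (π u) (π v) = ∑ π : Arrangement V, f (π u') (π v') := by
  obtain ⟨σ, rfl, rfl⟩ := MulAction.is_two_pretransitive_iff.1
    (Equiv.Perm.isMultiplyPretransitive V 2) h h'
  exact Fintype.sum_equiv (Equiv.equivCongr σ (Equiv.refl _)) _ _ fun π => by simp

theorem sum_arrangement_abs_sub [DecidableEq V] {u v : V} (h : u ≠ v) :
    3 * ∑ π : Arrangement V, |(π u : ℤ) - π v| =
      ((Fintype.card V)! : ℤ) * (Fintype.card V + 1) := by
  set n := Fintype.card V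
  have hn : 1 < n := Fintype.one_lt_card_iff.2 ⟨u, v, h⟩
  have hpair (x : V) : ∑ y, ∑ π : Arrangement V, |(π x : ℤ) - π y| =
      ((n : ℤ) - 1) * ∑ π : Arrangement V, |(π u : ℤ) - π v| := by
    rw [← Finset.add_sum_erase _ _ (Finset.mem_univ x), Finset.sum_congr rfl fun y hy =>
      sum_arrangement_congr (fun i j => |(i : ℤ) - j|) (Finset.ne_of_mem_erase hy).symm h,
      Finset.sum_const, Finset.card_erase_of_mem (Finset.mem_univ x), Finset.card_univ,
      nsmul_eq_mul, Nat.cast_sub hn.le]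
    simp [n]
  have hsym : ∑ x, ∑ y, ∑ π : Arrangement V, |(π x : ℤ) - π y| =
      (n : ℤ) * (n - 1) * ∑ π : Arrangement V, |(π u : ℤ) - π v| := by
    rw [Finset.sum_congr rfl fun x _ => hpair x, Finset.sum_const, Finset.card_univ, nsmul_eq_mul,
      mul_assoc]
  have hswap : 3 * ∑ x, ∑ y, ∑ π : Arrangement V, |(π x : ℤ) - π y| =
      (n ! : ℤ) * ((n : ℤ) ^ 3 - n) := by
    rw [Finset.sum_congr rfl fun x _ => Finset.sum_comm, Finset.sum_comm, Finset.mul_sum,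
      Finset.sum_congr rfl fun π _ => sum_sum_abs_sub π, Finset.sum_const, Finset.card_univ,
      card_arrangement, nsmul_eq_mul]
  have hne : (n : ℤ) * (n - 1) ≠ 0 := mul_ne_zero (by omega) (by omega)
  refine mul_left_cancel₀ hne ?_
  linear_combination hswap - 3 * hsym

theorem expSumLengths_eq {T : SimpleGraph V} (hT : T.IsTree) :
    expSumLengths T = ((Fintype.card V : ℝ) ^ 2 - 1) / 3 := by
  classical
  have hedge : ∀ e ∈ T.edgeFinset, 3 * ∑ π : Arrangement V, edgeLength π e =
      ((Fintype.card V)! : ℝ) * (Fintype.card V + 1) := by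
    intro e he
    induction e with | _ u v =>
    have huv : T.Adj u v := SimpleGraph.mem_edgeFinset.1 he
    simp only [edgeLength_mk]
    exact_mod_cast sum_arrangement_abs_sub huv.ne
  have hcard : (T.edgeFinset.card : ℝ) + 1 = Fintype.card V := mod_cast hT.card_edgeFinset
  have hsum : 3 * ∑ π, sumEdgeLengths T π =
      ((Fintype.card V : ℝ) - 1) * (((Fintype.card V)! : ℝ) * (Fintype.card V + 1)) := by
    simp only [sumEdgeLengths_eq]
    rw [Finset.sum_comm, Finset.mul_sum, Finset.sum_congr rfl hedge, Finset.sum_const,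
      nsmul_eq_mul, ← hcard, add_sub_cancel_right]
  have hfact : ((Fintype.card V)! : ℝ) ≠ 0 := by positivity
  rw [expSumLengths, arrangementLaw, ← Finset.coe_univ, integral_uniformOn, Finset.card_univ,
    card_arrangement]
  field_simp
  linear_combination hsum

theorem card_mul_prod_factorial_degree_lt {T : SimpleGraph V} [DecidableRel T.Adj]
    (hT : T.IsTree) (h : ∃ π : Arrangement V, 1 ≤ crossings T π) :
    Fintype.card V * ∏ x, (T.degree x)! < (Fintype.card V)! := by
  have hpos := probCrossing_pos h
  rw [probCrossing_eq, numPlanar_eq hT, div_pos_iff_of_pos_right (by positivity), sub_pos] at hpos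
  exact_mod_cast hpos

variable [DecidableEq V] {T : SimpleGraph V} [DecidableRel T.Adj]

/-- The contribution of an edge `uv` to the expected sum of edge lengths in planar
arrangements. -/
noncomputable def planarWeight (T : SimpleGraph V) [DecidableRel T.Adj] : Sym2 V → ℤ :=
  Sym2.lift ⟨fun u v => (side T u v).card * (side T v u).card -
    ((T.degree u : ℤ) - 1) * (side T u v).card ^ 2 -
    ((T.degree v : ℤ) - 1) * (side T v u).card ^ 2, fun _ _ => by ring⟩

theorem planarWeight_mk (T : SimpleGraph V) [DecidableRel T.Adj] (u v : V) :
    planarWeight T s(u, v) = (side T u v).card * (side T v u).card -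
      ((T.degree u : ℤ) - 1) * (side T u v).card ^ 2 -
      ((T.degree v : ℤ) - 1) * (side T v u).card ^ 2 :=
  rfl

theorem sum_otherSquares (T : SimpleGraph V) [DecidableRel T.Adj] (u : V) :
    ∑ v ∈ T.neighborFinset u, otherSquares T u v =
      ∑ v ∈ T.neighborFinset u, ((T.degree u : ℤ) - 1) * (side T u v).card ^ 2 := by
  have h : ∀ v ∈ T.neighborFinset u, otherSquares T u v =
      ∑ c ∈ T.neighborFinset u, ((side T u c).card : ℤ) ^ 2 - (side T u v).card ^ 2 :=
    fun v hv => eq_sub_of_add_eq (Finset.sum_erase_add _ _ hv)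
  rw [Finset.sum_congr rfl h, Finset.sum_sub_distrib, Finset.sum_const, nsmul_eq_mul,
    ← Finset.mul_sum, sub_mul, one_mul, SimpleGraph.card_neighborFinset_eq_degree]

open scoped Classical in
theorem sum_planarArrangements_abs_sub (hT : T.IsTree) {u v : V} (huv : T.Adj u v) :
    3 * ∑ π ∈ (planarArrangements T).toFinset, |(π u : ℤ) - π v| =
      (∏ x, ((T.degree x)! : ℤ)) * ((Fintype.card V : ℤ) ^ 2 + Fintype.card V - 1 +
        (side T u v).card * (side T v u).card - otherSquares T u v - otherSquares T v u) := by
  have hlists := sum_planarArrangements T u fun l => |(l.idxOf u : ℤ) - l.idxOf v|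
  simp only [Arrangement.idxOf_toList] at hlists
  rw [hlists, ← sum_planarLists_gap hT huv, Finset.mul_sum, Finset.mul_sum]
  refine Finset.sum_congr rfl fun l hl => ?_
  obtain ⟨m, hlm⟩ := exists_cons_of_mem_planarLists hl
  obtain ⟨hn, hm, -⟩ := mem_planarLists_univ.1 hl
  rw [← length_eq_card hn hm, sum_rotate_abs_idxOf_sub hlm hn (hm v)]
  ring

open scoped Classical in
theorem sum_sumEdgeLengths_planarArrangements (hT : T.IsTree) :
    3 * ∑ π ∈ (planarArrangements T).toFinset, sumEdgeLengths T π =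
      (∏ x, ((T.degree x)! : ℝ)) * (((Fintype.card V : ℝ) - 1) *
        ((Fintype.card V : ℝ) ^ 2 + Fintype.card V - 1) +
          ∑ e ∈ T.edgeFinset, (planarWeight T e : ℝ)) := by
  set M := ∏ x, ((T.degree x)! : ℝ)
  set c := (Fintype.card V : ℝ) ^ 2 + Fintype.card V - 1
  let F (e : Sym2 V) : ℝ :=
    3 * ∑ π ∈ (planarArrangements T).toFinset, edgeLength π e - M * (c + planarWeight T e)
  let excess (u v : V) : ℝ :=
    ((T.degree u : ℝ) - 1) * (side T u v).card ^ 2 - otherSquares T u v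
  have hexcess : ∑ u, ∑ v ∈ T.neighborFinset u, excess u v = 0 := by
    refine Finset.sum_eq_zero fun u _ => ?_
    have h := congrArg (Int.cast (R := ℝ)) (sum_otherSquares T u)
    push_cast at h
    rw [Finset.sum_sub_distrib, h, sub_self]
  have hedge : ∀ u v, T.Adj u v → F s(u, v) = M * excess u v + M * excess v u := by
    intro u v huv
    have h := congrArg (Int.cast (R := ℝ)) (sum_planarArrangements_abs_sub hT huv)
    simp only [edgeLength_mk, planarWeight_mk, excess, F]
    push_cast at h ⊢
    linear_combination h
  have hcard : (T.edgeFinset.card : ℝ) + 1 = Fintype.card V := mod_cast hT.card_edgeFinset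
  have hsum := sum_edgeFinset_eq_sum_neighborFinset hedge
  simp only [F, Finset.sum_sub_distrib, ← Finset.mul_sum, Finset.sum_add_distrib, Finset.sum_const,
    nsmul_eq_mul, hexcess, mul_zero] at hsum
  simp only [sumEdgeLengths_eq]
  rw [Finset.sum_comm, ← hcard]
  linear_combination hsum

theorem expSumLengthsPlanar_eq (hT : T.IsTree) :
    expSumLengthsPlanar T = (((Fintype.card V : ℝ) - 1) *
      ((Fintype.card V : ℝ) ^ 2 + Fintype.card V - 1) +
        ∑ e ∈ T.edgeFinset, (planarWeight T e : ℝ)) / (3 * Fintype.card V) := by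
  classical
  have hsum := sum_sumEdgeLengths_planarArrangements hT
  have hcard : ((planarArrangements T).toFinset.card : ℝ) =
      Fintype.card V * ∏ x, ((T.degree x)! : ℝ) := by
    rw [← Set.ncard_eq_toFinset_card']
    exact_mod_cast numPlanar_eq hT
  have hpos : (Fintype.card V : ℝ) ≠ 0 := by
    have := hT.1.nonempty
    exact Nat.cast_ne_zero.2 Fintype.card_ne_zero
  have hfact : ∏ x, ((T.degree x)! : ℝ) ≠ 0 := by positivity
  rw [expSumLengthsPlanar, ← Set.coe_toFinset (planarArrangements T), integral_uniformOn, hcard]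
  field_simp
  linear_combination hsum

theorem expSumLengthsCrossing_eq_div (hT : T.IsTree)
    (h : ∃ π : Arrangement V, 1 ≤ crossings T π) :
    expSumLengthsCrossing T =
      (((Fintype.card V)! : ℝ) * ((Fintype.card V : ℝ) ^ 2 - 1) -
        (∏ x, ((T.degree x)! : ℝ)) * (((Fintype.card V : ℝ) - 1) *
          ((Fintype.card V : ℝ) ^ 2 + Fintype.card V - 1) +
            ∑ e ∈ T.edgeFinset, (planarWeight T e : ℝ))) /
      (3 * (((Fintype.card V)! : ℝ) - Fintype.card V * ∏ x, ((T.degree x)! : ℝ))) := by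
  have hpos : (Fintype.card V : ℝ) ≠ 0 := by
    have := hT.1.nonempty
    exact Nat.cast_ne_zero.2 Fintype.card_ne_zero
  have hfact : ((Fintype.card V)! : ℝ) ≠ 0 := by positivity
  have hne : ((Fintype.card V)! : ℝ) - Fintype.card V * ∏ x, ((T.degree x)! : ℝ) ≠ 0 :=
    sub_ne_zero.2 (mod_cast (card_mul_prod_factorial_degree_lt hT h).ne')
  rw [expSumLengthsCrossing_eq h, expSumLengths_eq hT, expSumLengthsPlanar_eq hT,
    probNoCrossing_eq, probCrossing_eq, numPlanar_eq hT]
  push_cast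
  field_simp

end Totals

/-! ### Programs with a time credit -/

namespace RAM

variable {S W k : ℕ} {σ : State} {Q R : ℕ → State → Prop}

/-- Started in `σ` with a time credit `k`, the program halts in a state that satisfies `Q` together
with the remaining credit. Credits make the running times of loops compose: an invariant states
how much credit is still available. -/
def Runs (S W : ℕ) (p : Prog) (k : ℕ) (σ : State) (Q : ℕ → State → Prop) : Prop :=
  ∃ t σ' k', Exec S W p σ t σ' ∧ t + k' ≤ k ∧ Q k' σ'

theorem Runs.seq {p q : Prog} (hp : Runs S W p k σ Q) (hq : ∀ k σ, Q k σ → Runs S W q k σ R) :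
    Runs S W (.seq p q) k σ R := by
  obtain ⟨t, σ', k', hexec, ht, hQ⟩ := hp
  obtain ⟨t', σ'', k'', hexec', ht', hR⟩ := hq k' σ' hQ
  exact ⟨t + t', σ'', k'', .seq hexec hexec', by omega, hR⟩

theorem Runs.mono {p : Prog} (hp : Runs S W p k σ Q) (h : ∀ k σ, Q k σ → R k σ) :
    Runs S W p k σ R := by
  obtain ⟨t, σ', k', hexec, ht, hQ⟩ := hp
  exact ⟨t, σ', k', hexec, ht, h k' σ' hQ⟩

theorem Runs.loop {b : Test} {p : Prog} {I : ℕ → State → Prop}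
    (hI : ∀ k σ, I (k + 1) σ → b.Holds σ → Runs S W p k σ I)
    (hpos : ∀ k σ, I k σ → 0 < k) (h : I k σ) :
    Runs S W (.loop b p) k σ fun k' σ' => ¬ b.Holds σ' ∧ I (k' + 1) σ' := by
  induction k using Nat.strong_induction_on generalizing σ with
  | _ k ih =>
    obtain ⟨k, rfl⟩ := Nat.exists_eq_add_one.2 (hpos k σ h)
    by_cases hb : b.Holds σ
    · obtain ⟨t, σ', k', hexec, ht, hσ'⟩ := hI k σ h hb
      obtain ⟨t', σ'', k'', hexec', ht', hQ⟩ := ih k' (by omega) hσ'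
      exact ⟨t + t' + 1, σ'', k'', .loop_true hb hexec hexec', by omega, hQ⟩
    · exact ⟨1, σ, k, .loop_false hb, by omega, hb, h⟩

theorem Runs.ite_skip {b : Test} {p : Prog} (hp : b.Holds σ → Runs S W p k σ Q)
    (hskip : ¬ b.Holds σ → Q k σ) : Runs S W (.ite b p .skip) (k + 1) σ Q := by
  by_cases hb : b.Holds σ
  · obtain ⟨t, σ', k', hexec, ht, hQ⟩ := hp hb
    exact ⟨t + 1, σ', k', .ite_true hb hexec, by omega, hQ⟩
  · exact ⟨0 + 1, σ, k, .ite_false hb (.skip σ), by omega, hskip hb⟩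

/-- The straight-line program that consists of the given instructions. -/
def block : List Instr → Prog
  | [] => .skip
  | c :: cs => .seq (.instr c) (block cs)

/-- The state to which a straight-line program leads. -/
def run (cs : List Instr) (σ : State) : State := cs.foldl Instr.apply σ

/-- Each instruction of a straight-line program is legal in the state reached before it. -/
def BlockLegal (S W : ℕ) : List Instr → State → Prop
  | [], _ => True
  | c :: cs, σ => c.Legal S W σ ∧ BlockLegal S W cs (c.apply σ)

theorem run_append (cs cs' : List Instr) (σ : State) : run (cs ++ cs') σ = run cs' (run cs σ) :=
  List.foldl_append

theorem BlockLegal.append {cs cs' : List Instr} (h : BlockLegal S W cs σ)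
    (h' : BlockLegal S W cs' (run cs σ)) : BlockLegal S W (cs ++ cs') σ := by
  induction cs generalizing σ with
  | nil => exact h'
  | cons c cs ih => exact ⟨h.1, ih h.2 h'⟩

theorem exec_block {cs : List Instr} (h : BlockLegal S W cs σ) :
    Exec S W (block cs) σ cs.length (run cs σ) := by
  induction cs generalizing σ with
  | nil => exact .skip σ
  | cons c cs ih =>
    rw [List.length_cons, add_comm]
    exact .seq (.instr c σ h.1) (ih h.2)

theorem Runs.block {cs : List Instr} (h : BlockLegal S W cs σ) (hk : cs.length ≤ k)
    (hQ : Q (k - cs.length) (run cs σ)) : Runs S W (block cs) k σ Q :=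
  ⟨cs.length, run cs σ, k - cs.length, exec_block h, by omega, hQ⟩

end RAM

/-! ### The program -/

namespace RAM

/-- Record that `word y` is a neighbour of `word x`. -/
def recordBlock (x y : ℕ) : List Instr :=
  [.wordLoad 5 5 x, .wordAdd 5 5 1, .wordStore 2 x 5, .wordStore 5 x 5, .numOfWord 3 5,
    .numMul 1 1 3, .wordLoad 5 3 x, .wordAdd 5 5 y, .wordStore 3 x 5]

/-- Load the ends of the edge `word 2`. -/
def loadBlock : List Instr := [.wordLoad 3 0 2, .wordLoad 4 1 2]

/-- Read the edge `word 2` and record it at both of its ends. -/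
def readBlock : List Instr :=
  loadBlock ++ (recordBlock 3 4 ++ recordBlock 4 3 ++ [.wordAdd 2 2 1])

/-- Set the constant one and the two products. -/
def initBlock : List Instr := [.wordConst 1 1, .wordSub 6 0 1, .numOfWord 1 1, .numOfWord 2 1]

/-- Let `word 9` be the distance from one of the current degree of the vertex `word 7`. -/
def testBlock : List Instr := [.wordLoad 9 2 7, .wordSub 5 9 1, .wordSub 9 1 9, .wordAdd 9 9 5]

/-- Let `word 7` be the vertex `word 2`, and extend the factorial. -/
def lookBlock : List Instr :=
  [.wordAdd 7 2 10, .wordAdd 2 2 1, .numOfWord 3 2, .numMul 2 2 3]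

/-- Accumulate the weight of the edge that joins the leaf `word 7` to its neighbour, and find the
neighbour `word 8` and the size `word 11` of the leaf's side. -/
def weighBlock : List Instr :=
  [.wordLoad 8 3 7, .wordLoad 11 4 7, .wordAdd 11 11 1,
    .numOfWord 5 11, .numOfWord 6 0, .numSub 6 6 5, .numMul 7 5 6, .numAdd 4 4 7,
    .wordLoad 5 5 8, .wordSub 5 5 1, .numOfWord 7 5, .numMul 7 7 5, .numMul 7 7 5, .numSub 4 4 7,
    .wordLoad 5 5 7, .wordSub 5 5 1, .numOfWord 7 5, .numMul 7 7 6, .numMul 7 7 6, .numSub 4 4 7]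

/-- Delete the edge that joins the leaf `word 7` to `word 8`, and move on to `word 8`. -/
def detachBlock : List Instr :=
  [.wordStore 2 7 10, .wordLoad 5 2 8, .wordSub 5 5 1, .wordStore 2 8 5,
    .wordStore 3 7 10, .wordLoad 5 3 8, .wordSub 5 5 7, .wordStore 3 8 5,
    .wordLoad 5 4 8, .wordAdd 5 5 11, .wordStore 4 8 5, .wordAdd 7 8 10]

/-- Remove the leaf `word 7` and test whether its neighbour has become a leaf. -/
def peelBlock : List Instr := weighBlock ++ (detachBlock ++ testBlock)

/-- Compute the numerator and the denominator of the conditional expectation. -/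
def finishBlock : List Instr :=
  [.numOfWord 5 0, .numOfWord 6 1, .numMul 7 5 5, .numSub 8 7 6, .numMul 8 8 2,
    .numAdd 7 7 5, .numSub 7 7 6, .numSub 3 5 6, .numMul 3 3 7, .numAdd 3 3 4, .numMul 3 3 1,
    .numSub 8 8 3, .numMul 5 5 1, .numSub 5 2 5, .numAdd 6 5 5, .numAdd 5 6 5]

/-- Read all edges. -/
def readProg : Prog := .loop (.wordLt 2 6) (block readBlock)

/-- Remove leaves, starting from `word 7`, as long as the vertex reached is a leaf. -/
def peelLoop : Prog := .loop (.wordLt 9 1) (block peelBlock)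

/-- Delete all edges, leaf by leaf. -/
def peelProg : Prog := .loop (.wordLt 2 0) (.seq (block (lookBlock ++ testBlock)) peelLoop)

/-- The program for the conditional expectation of the sum of edge lengths, given that there is a
crossing. -/
def crossingProg : Prog :=
  .seq (block initBlock) (.seq readProg (.seq (block [.wordSub 2 2 2]) (.seq peelProg
    (.seq (block finishBlock) (.ite (.numLt 10 5) (block [.numDiv 0 8 5]) .skip)))))

/-! ### The data kept in memory -/

variable {n S W : ℕ} {l : List (Fin n × Fin n)} {σ : State}

/-- The mathematical content of the memory during the computation: the current degrees and the sums
of the neighbours in a graph that grows to the tree and is then dismantled leaf by leaf, the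
degrees in the tree, for each vertex the number of vertices already cut off behind it, and three
accumulated numbers. -/
structure Data (n : ℕ) where
  counter : ℕ
  degree : Fin n → ℕ
  current : Fin n → ℕ
  nbrSum : Fin n → ℕ
  cut : Fin n → ℕ
  prod : ℚ
  fact : ℚ
  acc : ℚ

/-- The memory holds the data `d`, and the input edges and the constants are where the program
expects them. The variables that are not mentioned are scratch registers, except that
`word 7`, `word 8`, `word 9` and `word 11` describe the leaf that is being removed. -/
structure Represents (l : List (Fin n × Fin n)) (d : Data n) (σ : State) : Prop where
  order : σ.word 0 = n
  one : σ.word 1 = 1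
  counter : σ.word 2 = d.counter
  size : σ.word 6 = n - 1
  zero : σ.word 10 = 0
  fst : σ.wordArr 0 = fun i => (l.map fun e => (e.1 : ℕ)).getD i 0
  snd : σ.wordArr 1 = fun i => (l.map fun e => (e.2 : ℕ)).getD i 0
  current : ∀ z : Fin n, σ.wordArr 2 z = d.current z
  nbrSum : ∀ z : Fin n, σ.wordArr 3 z = d.nbrSum z
  cut : ∀ z : Fin n, σ.wordArr 4 z = d.cut z
  degree : ∀ z : Fin n, σ.wordArr 5 z = d.degree z
  prod : σ.num 1 = d.prod
  fact : σ.num 2 = d.fact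
  acc : σ.num 4 = d.acc
  numZero : σ.num 10 = 0

/-- The machine is looking at the vertex `v`: it holds `v` together with the distance from one of
its current degree, which tells whether `v` is a leaf. -/
def Looking (d : Data n) (v : Fin n) (σ : State) : Prop :=
  σ.word 7 = v ∧ σ.word 9 = (1 - d.current v) + (d.current v - 1)

namespace Data

/-- Record that `b` is a neighbour of `a`. -/
def record (d : Data n) (a b : Fin n) : Data n :=
  { d with
    degree := Function.update d.degree a (d.degree a + 1)
    current := Function.update d.current a (d.degree a + 1)
    nbrSum := Function.update d.nbrSum a (d.nbrSum a + b)
    prod := d.prod * (d.degree a + 1 : ℕ) }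

/-- Proceed to the next listed edge. -/
def next (d : Data n) : Data n := { d with counter := d.counter + 1 }

/-- Proceed to the next vertex and extend the factorial. -/
def look (d : Data n) : Data n :=
  { d with counter := d.counter + 1, fact := d.fact * (d.counter + 1 : ℕ) }

/-- Accumulate the weight of the edge that joins the leaf `v` to `u`. -/
def weigh (d : Data n) (v u : Fin n) : Data n :=
  { d with
    acc := d.acc + (d.cut v + 1) * (n - (d.cut v + 1)) -
      (d.degree u - 1 : ℕ) * (d.cut v + 1) * (d.cut v + 1) -
      (d.degree v - 1 : ℕ) * (n - (d.cut v + 1)) * (n - (d.cut v + 1)) }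

/-- Delete the edge that joins the leaf `v` to `u`. -/
def detach (d : Data n) (v u : Fin n) : Data n :=
  { d with
    current := Function.update (Function.update d.current v 0) u (d.current u - 1)
    nbrSum := Function.update (Function.update d.nbrSum v 0) u (d.nbrSum u - v)
    cut := Function.update d.cut u (d.cut u + (d.cut v + 1)) }

end Data

theorem update_val {α : Type*} {f : ℕ → α} {g : Fin n → α} (h : ∀ z : Fin n, f z = g z)
    (a : Fin n) (c : α) (z : Fin n) : Function.update f a c z = Function.update g a c z := by
  simp only [Function.update_apply, h, Fin.val_inj]

variable {d : Data n} {a b u v : Fin n} {x y : ℕ}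

theorem word_run_recordBlock {z : ℕ} (hz : z ≠ 5) :
    (run (recordBlock x y) σ).word z = σ.word z := by
  simp [run, recordBlock, Instr.apply, hz]

theorem recordBlock_legal (h : Represents l d σ) (hx : σ.word x = a) (hy : σ.word y = b)
    (hx5 : x ≠ 5) (hy5 : y ≠ 5) (hS : n ≤ S) (hdeg : d.degree a + 1 < W)
    (hsum : d.nbrSum a + b < W) : BlockLegal S W (recordBlock x y) σ := by
  simp [recordBlock, BlockLegal, Instr.Legal, Instr.apply, hx, hy, hx5, hy5, h.one, h.degree,
    h.nbrSum, hdeg, hsum, a.2.trans_le hS]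

theorem Represents.recordBlock (h : Represents l d σ) (hx : σ.word x = a) (hy : σ.word y = b)
    (hx5 : x ≠ 5) (hy5 : y ≠ 5) : Represents l (d.record a b) (run (recordBlock x y) σ) := by
  cases h
  constructor <;> simp [run, RAM.recordBlock, Instr.apply, update_val, Data.record, *]

theorem Represents.initBlock (l : List (Fin n × Fin n)) :
    Represents l ⟨0, 0, 0, 0, 0, 1, 1, 0⟩ (run initBlock (input l)) := by
  constructor <;> simp [run, RAM.initBlock, Instr.apply, input]

theorem initBlock_legal (hW : 1 < W) : BlockLegal S W initBlock σ := by
  simp [initBlock, BlockLegal, Instr.Legal, hW]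

theorem Represents.loadBlock (h : Represents l d σ) : Represents l d (run loadBlock σ) := by
  cases h
  constructor <;> simp [run, RAM.loadBlock, Instr.apply, *]

theorem word_run_loadBlock (h : Represents l d σ) (hi : d.counter < l.length) :
    (run loadBlock σ).word 3 = l[d.counter].1 ∧ (run loadBlock σ).word 4 = l[d.counter].2 := by
  simp [run, loadBlock, Instr.apply, h.counter, h.fst, h.snd, hi]

theorem loadBlock_legal (h : Represents l d σ) (hS : d.counter < S) :
    BlockLegal S W loadBlock σ := by
  simp [loadBlock, BlockLegal, Instr.Legal, Instr.apply, h.counter, hS]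

theorem Represents.wordAdd_counter (h : Represents l d σ) :
    Represents l d.next (run [.wordAdd 2 2 1] σ) := by
  cases h
  constructor <;> simp [run, Instr.apply, Data.next, *]

theorem wordAdd_counter_legal (h : Represents l d σ) (hW : d.counter + 1 < W) :
    BlockLegal S W [.wordAdd 2 2 1] σ := by
  simp [BlockLegal, Instr.Legal, h.counter, h.one, hW]

theorem Represents.wordSub_counter (h : Represents l d σ) :
    Represents l { d with counter := 0 } (run [.wordSub 2 2 2] σ) := by
  cases h
  constructor <;> simp [run, Instr.apply, *]

theorem Represents.recordBlock_recordBlock (h : Represents l d σ) (h3 : σ.word 3 = a)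
    (h4 : σ.word 4 = b) : Represents l ((d.record a b).record b a)
      (run (RAM.recordBlock 3 4 ++ RAM.recordBlock 4 3) σ) := by
  rw [run_append]
  exact (h.recordBlock h3 h4 (by decide) (by decide)).recordBlock
    ((word_run_recordBlock (by decide)).trans h4) ((word_run_recordBlock (by decide)).trans h3)
    (by decide) (by decide)

theorem recordBlock_recordBlock_legal (h : Represents l d σ) (h3 : σ.word 3 = a)
    (h4 : σ.word 4 = b) (hab : a ≠ b) (hS : n ≤ S) (hdeg : ∀ z, d.degree z + 1 < W)
    (hsum : ∀ z w : Fin n, d.nbrSum z + w < W) :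
    BlockLegal S W (recordBlock 3 4 ++ recordBlock 4 3) σ := by
  refine (recordBlock_legal h h3 h4 (by decide) (by decide) hS (hdeg a) (hsum a b)).append
    (recordBlock_legal (h.recordBlock h3 h4 (by decide) (by decide))
      ((word_run_recordBlock (by decide)).trans h4) ((word_run_recordBlock (by decide)).trans h3)
      (by decide) (by decide) hS ?_ ?_)
  · simpa [Data.record, hab.symm] using hdeg b
  · simpa [Data.record, hab.symm] using hsum b a

theorem Represents.readBlock (h : Represents l d σ) (hi : d.counter < l.length) :
    Represents l ((d.record l[d.counter].1 l[d.counter].2).record l[d.counter].2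
      l[d.counter].1).next (run readBlock σ) := by
  obtain ⟨h3, h4⟩ := word_run_loadBlock h hi
  rw [RAM.readBlock, run_append, run_append]
  exact (h.loadBlock.recordBlock_recordBlock h3 h4).wordAdd_counter

theorem readBlock_legal (h : Represents l d σ) (hi : d.counter < l.length)
    (hne : l[d.counter].1 ≠ l[d.counter].2) (hS : n ≤ S) (hiS : d.counter < S)
    (hiW : d.counter + 1 < W) (hdeg : ∀ z, d.degree z + 1 < W)
    (hsum : ∀ z w : Fin n, d.nbrSum z + w < W) : BlockLegal S W readBlock σ := by
  obtain ⟨h3, h4⟩ := word_run_loadBlock h hi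
  exact (loadBlock_legal h hiS).append
    ((recordBlock_recordBlock_legal h.loadBlock h3 h4 hne hS hdeg hsum).append
      (wordAdd_counter_legal (h.loadBlock.recordBlock_recordBlock h3 h4) hiW))

theorem lookBlock_legal (h : Represents l d σ) (hW : d.counter + 1 < W) :
    BlockLegal S W lookBlock σ := by
  have hlt : d.counter < W := Nat.lt_of_succ_lt hW
  simp [lookBlock, BlockLegal, Instr.Legal, Instr.apply, hW, hlt, h.one, h.zero, h.counter]

theorem Represents.lookBlock (h : Represents l d σ) :
    Represents l d.look (run lookBlock σ) := by
  cases h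
  constructor <;> simp [run, RAM.lookBlock, Instr.apply, Data.look, *]

theorem word_run_lookBlock (h : Represents l d σ) : (run lookBlock σ).word 7 = d.counter := by
  simp [run, lookBlock, Instr.apply, h.counter, h.zero]

theorem testBlock_legal (h : Represents l d σ) (h7 : σ.word 7 = v) (hS : n ≤ S) (hW : 1 < W)
    (hcurrent : d.current v < W) : BlockLegal S W testBlock σ := by
  have hdist : (1 - d.current v) + (d.current v - 1) < W := by omega
  simp [testBlock, BlockLegal, Instr.Legal, Instr.apply, h7, h.one, h.current, hdist,
    v.2.trans_le hS]

theorem Represents.testBlock (h : Represents l d σ) : Represents l d (run testBlock σ) := by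
  cases h
  constructor <;> simp [run, RAM.testBlock, Instr.apply, *]

theorem looking_run_testBlock (h : Represents l d σ) (h7 : σ.word 7 = v) :
    Looking d v (run testBlock σ) := by
  simp [Looking, run, testBlock, Instr.apply, h7, h.one, h.current]

theorem weighBlock_legal (h : Represents l d σ) (h7 : σ.word 7 = v) (hu : d.nbrSum v = u)
    (hS : n ≤ S) (hcut : d.cut v + 1 < W) : BlockLegal S W weighBlock σ := by
  simp [weighBlock, BlockLegal, Instr.Legal, Instr.apply, h7, hu, h.one, h.nbrSum, h.cut, hcut,
    u.2.trans_le hS, v.2.trans_le hS]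

theorem Represents.weighBlock (h : Represents l d σ) (h7 : σ.word 7 = v) (hu : d.nbrSum v = u) :
    Represents l (d.weigh v u) (run weighBlock σ) := by
  cases h
  constructor <;> simp [run, RAM.weighBlock, Instr.apply, Data.weigh, *]

theorem word_run_weighBlock (h : Represents l d σ) (h7 : σ.word 7 = v) (hu : d.nbrSum v = u) :
    (run weighBlock σ).word 7 = v ∧ (run weighBlock σ).word 8 = u ∧
      (run weighBlock σ).word 11 = d.cut v + 1 := by
  simp [run, weighBlock, Instr.apply, h7, hu, h.one, h.nbrSum, h.cut]

theorem detachBlock_legal (h : Represents l d σ) (h7 : σ.word 7 = v) (h8 : σ.word 8 = u)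
    (h11 : σ.word 11 = d.cut v + 1) (hS : n ≤ S) (hcut : d.cut u + (d.cut v + 1) < W)
    (hu : u < W) : BlockLegal S W detachBlock σ := by
  simp [detachBlock, BlockLegal, Instr.Legal, Instr.apply, h7, h8, h11, h.zero, h.cut, hcut, hu,
    u.2.trans_le hS, v.2.trans_le hS]

theorem Represents.detachBlock (h : Represents l d σ) (h7 : σ.word 7 = v) (h8 : σ.word 8 = u)
    (h11 : σ.word 11 = d.cut v + 1) (huv : (u : ℕ) ≠ v) :
    Represents l (d.detach v u) (run detachBlock σ) := by
  cases h
  constructor <;> simp [run, RAM.detachBlock, Instr.apply, update_val, Data.detach, *]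

theorem word_run_detachBlock (h : Represents l d σ) (h8 : σ.word 8 = u) :
    (run detachBlock σ).word 7 = u := by
  simp [run, detachBlock, Instr.apply, h8, h.zero]

theorem Represents.peelBlock (h : Represents l d σ) (h7 : σ.word 7 = v) (hu : d.nbrSum v = u)
    (huv : (u : ℕ) ≠ v) : Represents l ((d.weigh v u).detach v u) (run peelBlock σ) := by
  obtain ⟨h7', h8, h11⟩ := word_run_weighBlock h h7 hu
  rw [RAM.peelBlock, run_append, run_append]
  exact ((h.weighBlock h7 hu).detachBlock h7' h8 h11 huv).testBlock

theorem looking_run_peelBlock (h : Represents l d σ) (h7 : σ.word 7 = v) (hu : d.nbrSum v = u)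
    (huv : (u : ℕ) ≠ v) : Looking ((d.weigh v u).detach v u) u (run peelBlock σ) := by
  obtain ⟨h7', h8, h11⟩ := word_run_weighBlock h h7 hu
  have hw := h.weighBlock h7 hu
  rw [peelBlock, run_append, run_append]
  exact looking_run_testBlock (hw.detachBlock h7' h8 h11 huv) (word_run_detachBlock hw h8)

theorem peelBlock_legal (h : Represents l d σ) (h7 : σ.word 7 = v) (hu : d.nbrSum v = u)
    (huv : (u : ℕ) ≠ v) (hS : n ≤ S) (hW : n < W) (hcurrent : d.current u < W)
    (hcut : d.cut u + (d.cut v + 1) < W) : BlockLegal S W peelBlock σ := by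
  obtain ⟨h7', h8, h11⟩ := word_run_weighBlock h h7 hu
  have hw := h.weighBlock h7 hu
  have hlt : (1 : ℕ) < W := by omega
  refine (weighBlock_legal h h7 hu hS (by omega)).append (BlockLegal.append
    (detachBlock_legal hw h7' h8 h11 hS hcut (u.2.trans hW))
    (testBlock_legal (hw.detachBlock h7' h8 h11 huv) (word_run_detachBlock hw h8) hS hlt ?_))
  simpa [Data.detach, Data.weigh] using (Nat.sub_le _ _).trans_lt hcurrent

theorem finishBlock_legal : BlockLegal S W finishBlock σ := by
  simp [finishBlock, BlockLegal, Instr.Legal]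

theorem num_run_finishBlock (h : Represents l d σ) :
    (run finishBlock σ).num 10 = 0 ∧
      (run finishBlock σ).num 5 = 3 * (d.fact - n * d.prod) ∧
      (run finishBlock σ).num 8 = d.fact * ((n : ℚ) ^ 2 - 1) -
        d.prod * ((n - 1) * ((n : ℚ) ^ 2 + n - 1) + d.acc) := by
  simp only [run, finishBlock, List.foldl_cons, List.foldl_nil, Instr.apply, h.order, h.one]
  refine ⟨?_, ?_, ?_⟩ <;> simp [h.prod, h.fact, h.acc, h.numZero] <;> ring

end RAM

/-! ### Deleting the edges of a tree one by one -/

section DeleteEdge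

variable {V : Type*} [Fintype V] {T R : SimpleGraph V} [DecidableRel R.Adj]
  {u v : V}

theorem neighborFinset_eq_singleton_of_degree_eq_one (hd : R.degree v = 1) (h : R.Adj v u) :
    R.neighborFinset v = {u} :=
  Finset.eq_singleton_iff_unique_mem.2 ⟨by simpa using h, fun _ hw =>
    Finset.card_le_one.1 hd.le _ hw _ (by simpa using h)⟩

theorem sum_edgeFinset_deleteEdges_singleton [DecidableRel (R.deleteEdges {s(v, u)}).Adj]
    {M : Type*} [AddCommMonoid M] (h : R.Adj v u) (f : Sym2 V → M) :
    ∑ e ∈ R.edgeFinset, f e = f s(v, u) + ∑ e ∈ (R.deleteEdges {s(v, u)}).edgeFinset, f e := by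
  classical
  have : (R.deleteEdges {s(v, u)}).edgeFinset = R.edgeFinset.erase s(v, u) := by
    ext e
    simp [and_comm]
  rw [this, Finset.add_sum_erase _ _ (SimpleGraph.mem_edgeFinset.2 h)]

variable [DecidableEq V]

theorem sum_neighborFinset_deleteEdges_singleton [DecidableRel (R.deleteEdges {s(v, u)}).Adj]
    {M : Type*} [AddCommMonoid M] (h : R.Adj v u) (f : V → M) (x : V) :
    ∑ y ∈ R.neighborFinset x, f y =
      ∑ y ∈ (R.deleteEdges {s(v, u)}).neighborFinset x, f y +
        ((if x = v then f u else 0) + if x = u then f v else 0) := by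
  have hvu := h.ne
  have hv : ∀ y, (R.Adj v y ∧ y = u) ↔ y = u := fun y => ⟨And.right, fun hy => ⟨hy ▸ h, hy⟩⟩
  have hu : ∀ y, (R.Adj u y ∧ y = v) ↔ y = v := fun y => ⟨And.right, fun hy => ⟨hy ▸ h.symm, hy⟩⟩
  have hdel : (R.deleteEdges {s(v, u)}).neighborFinset x =
      (R.neighborFinset x).filter fun y => ¬ s(x, y) = s(v, u) := by
    ext y
    simp
  rw [hdel, ← Finset.sum_filter_add_sum_filter_not (R.neighborFinset x) (s(x, ·) = s(v, u)),
    add_comm]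
  congr 1
  rcases eq_or_ne x v with rfl | hxv
  · have : (R.neighborFinset x).filter (fun y => s(x, y) = s(x, u)) = {u} := by
      ext y
      simp only [Finset.mem_filter, SimpleGraph.mem_neighborFinset, Finset.mem_singleton,
        Sym2.congr_right, hv]
    rw [this, Finset.sum_singleton, if_pos rfl, if_neg hvu, add_zero]
  rcases eq_or_ne x u with rfl | hxu
  · have : (R.neighborFinset x).filter (fun y => s(x, y) = s(v, x)) = {v} := by
      ext y
      simp only [Finset.mem_filter, SimpleGraph.mem_neighborFinset, Finset.mem_singleton,
        Sym2.eq_swap (a := v), Sym2.congr_right, hu]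
    rw [this, Finset.sum_singleton, if_neg hxv, if_pos rfl, zero_add]
  · rw [if_neg hxv, if_neg hxu, add_zero]
    exact Finset.sum_eq_zero fun y hy => by simp_all

theorem degree_deleteEdges_singleton [DecidableRel (R.deleteEdges {s(v, u)}).Adj]
    (h : R.Adj v u) (x : V) :
    R.degree x = (R.deleteEdges {s(v, u)}).degree x +
      ((if x = v then 1 else 0) + if x = u then 1 else 0) := by
  simpa only [Finset.sum_const, smul_eq_mul, mul_one, SimpleGraph.card_neighborFinset_eq_degree]
    using sum_neighborFinset_deleteEdges_singleton h (fun _ => (1 : ℕ)) x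

theorem card_side_add_card_side_lt (hT : T.IsTree) {w : V} (hvu : T.Adj v u) (hvw : T.Adj v w)
    (huw : u ≠ w) : (side T v u).card + (side T v w).card < Fintype.card V := by
  classical
  have hsum := sum_card_side_add_one hT v
  have hsub : ({u, w} : Finset V) ⊆ T.neighborFinset v := by
    simp [Finset.insert_subset_iff, hvu, hvw]
  have hle := Finset.sum_le_sum_of_subset (f := fun q => (side T v q).card) hsub
  rw [Finset.sum_pair huw] at hle
  omega

end DeleteEdge

/-- If every vertex that is not isolated in `R` had more than one neighbour, then a smallest side
that is cut off by an edge of `R` would contain a still smaller one. -/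
theorem eq_bot_of_degree_ne_one {V : Type*} [Fintype V] {T R : SimpleGraph V} [DecidableRel R.Adj]
    (hT : T.IsTree) (hR : R ≤ T) (h : ∀ x, R.degree x ≠ 1) :
    R = ⊥ := by
  classical
  by_contra hne
  obtain ⟨a, b, hab⟩ := SimpleGraph.ne_bot_iff_exists_adj.1 hne
  obtain ⟨⟨v, u⟩, hvu, hmin⟩ := Finset.exists_min_image
    (Finset.univ.filter fun q : V × V => R.Adj q.1 q.2) (fun q => (side T q.2 q.1).card)
    ⟨(a, b), by simpa using hab⟩
  simp only [Finset.mem_filter, Finset.mem_univ, true_and] at hvu hmin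
  have hdegree : 1 < (R.neighborFinset v).card :=
    lt_of_le_of_ne (Finset.card_pos.2 ⟨u, by simpa using hvu⟩) (h v).symm
  obtain ⟨w, hw, hwu⟩ := Finset.exists_mem_ne hdegree u
  rw [SimpleGraph.mem_neighborFinset] at hw
  have hlt := card_side_add_card_side_lt hT (hR hvu) (hR hw) hwu.symm
  have hle : (side T u v).card ≤ (side T v w).card := hmin (w, v) hw.symm
  have hadd := card_side_add_card_side hT (hR hvu)
  omega

namespace RAM

variable {n : ℕ} {T R R' : SimpleGraph (Fin n)} {l : List (Fin n × Fin n)}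

/-! ### Recording the edges -/

theorem IsEdgeList.unique (h : IsEdgeList R l) (h' : IsEdgeList R' l) : R = R' :=
  SimpleGraph.edgeSet_inj.1 (Set.ext fun e => (h.2 e).symm.trans (h'.2 e))

theorem IsEdgeList.exists_take (h : IsEdgeList T l) (i : ℕ) : ∃ R, IsEdgeList R (l.take i) := by
  refine ⟨.fromEdgeSet {e | e ∈ (l.take i).map fun e => s(e.1, e.2)},
    h.1.sublist ((List.take_sublist i l).map _), fun e => ?_⟩
  rw [SimpleGraph.edgeSet_fromEdgeSet, Set.mem_sdiff]
  refine ⟨fun he => ⟨he, ?_⟩, And.left⟩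
  exact T.not_isDiag_of_mem_edgeSet ((h.2 e).1 (((List.take_sublist i l).map _).subset he))

theorem IsEdgeList.of_append_singleton {e : Fin n × Fin n} (h : IsEdgeList R (l ++ [e])) :
    R.Adj e.1 e.2 ∧ IsEdgeList (R.deleteEdges {s(e.1, e.2)}) l := by
  obtain ⟨hnodup, hmem⟩ := h
  simp only [List.map_append, List.map_cons, List.map_nil, List.nodup_append,
    List.mem_append, List.mem_singleton] at hnodup hmem
  refine ⟨(hmem _).1 (.inr rfl), hnodup.1, fun e' => ?_⟩
  rw [SimpleGraph.edgeSet_deleteEdges, Set.mem_sdiff, ← hmem]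
  have := hnodup.2.2 e'
  simp only [Set.mem_singleton_iff]
  exact ⟨fun he => ⟨.inl he, this he _ rfl⟩, fun he => he.1.resolve_right he.2⟩

theorem IsEdgeList.length_add_one (h : IsEdgeList T l) (hT : T.IsTree) : l.length + 1 = n := by
  classical
  have hset : (l.map fun e => s(e.1, e.2)).toFinset = T.edgeFinset := by
    ext e
    simpa using h.2 e
  have hcard := hT.card_edgeFinset
  rwa [← hset, List.toFinset_card_of_nodup h.1, List.length_map, Fintype.card_fin] at hcard

/-- The data `d` are those of a machine that has read exactly the edges of `R`. -/
structure Records (R : SimpleGraph (Fin n)) [DecidableRel R.Adj] (d : Data n) : Prop where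
  degree : ∀ z, d.degree z = R.degree z
  current : ∀ z, d.current z = R.degree z
  nbrSum : ∀ z, d.nbrSum z = ∑ w ∈ R.neighborFinset z, (w : ℕ)
  cut : ∀ z, d.cut z = 0
  prod : d.prod = ∏ z, ((d.degree z)! : ℚ)
  fact : d.fact = 1
  acc : d.acc = 0

variable [DecidableRel R.Adj] {d : Data n} {a b : Fin n}

theorem Records.bot [DecidableRel (⊥ : SimpleGraph (Fin n)).Adj] :
    Records (⊥ : SimpleGraph (Fin n)) ⟨0, 0, 0, 0, 0, 1, 1, 0⟩ := by
  constructor <;> simp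

theorem Data.prod_record (h : d.prod = ∏ z, ((d.degree z)! : ℚ)) :
    (d.record a b).prod = ∏ z, (((d.record a b).degree z)! : ℚ) := by
  have hne : ∀ z ∈ ({a} : Finset (Fin n))ᶜ, ((d.record a b).degree z)! = (d.degree z)! :=
    fun z hz => by simp [Data.record, Finset.mem_compl.1 hz |> Finset.notMem_singleton.1]
  simp only [← Nat.cast_prod] at h ⊢
  rw [Fintype.prod_eq_mul_prod_compl a, Finset.prod_congr rfl hne]
  rw [Fintype.prod_eq_mul_prod_compl a] at h
  simp only [Data.record, Function.update_self, h, Nat.factorial_succ]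
  push_cast
  ring

theorem Records.record [DecidableRel (R.deleteEdges {s(a, b)}).Adj]
    (h : Records (R.deleteEdges {s(a, b)}) d) (hab : R.Adj a b) :
    Records R ((d.record a b).record b a).next := by
  have hne : a ≠ b := hab.ne
  have hsum := sum_neighborFinset_deleteEdges_singleton hab fun w => (w : ℕ)
  have hdeg := degree_deleteEdges_singleton hab
  refine ⟨fun z => ?_, fun z => ?_, fun z => ?_, h.cut, ?_, h.fact, h.acc⟩
  · rw [hdeg]
    rcases eq_or_ne z a with rfl | ha <;> rcases eq_or_ne z b with rfl | hb <;>
      simp_all [Data.next, Data.record, h.degree]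
  · rw [hdeg]
    rcases eq_or_ne z a with rfl | ha <;> rcases eq_or_ne z b with rfl | hb <;>
      simp_all [Data.next, Data.record, h.degree, h.current]
  · rw [hsum]
    rcases eq_or_ne z a with rfl | ha <;> rcases eq_or_ne z b with rfl | hb <;>
      simp_all [Data.next, Data.record, h.nbrSum]
  · exact Data.prod_record (b := a) (Data.prod_record (b := b) h.prod)

theorem Records.exists_record (hl : IsEdgeList T l)
    (hi : d.counter < l.length) (hR : IsEdgeList R (l.take d.counter)) (h : Records R d) :
    ∃ (R' : SimpleGraph (Fin n)) (_ : DecidableRel R'.Adj),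
      R'.Adj l[d.counter].1 l[d.counter].2 ∧ IsEdgeList R' (l.take (d.counter + 1)) ∧
      Records R' ((d.record l[d.counter].1 l[d.counter].2).record l[d.counter].2
        l[d.counter].1).next := by
  classical
  obtain ⟨R', hR'⟩ := hl.exists_take (d.counter + 1)
  have happend := hR'
  rw [List.take_add_one, List.getElem?_eq_getElem hi, Option.toList_some] at happend
  obtain ⟨hadj, hdel⟩ := happend.of_append_singleton
  obtain rfl := hR.unique hdel
  exact ⟨R', inferInstance, hadj, hR', h.record hadj⟩

theorem Records.nbrSum_add_lt (h : Records R d) (z w : Fin n) : d.nbrSum z + w < n * n := by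
  have hz : R.degree z < n := by simpa using R.degree_lt_card_verts z
  have hsum : ∑ y ∈ R.neighborFinset z, (y : ℕ) ≤ R.degree z * n := by
    simpa using Finset.sum_le_card_nsmul (R.neighborFinset z) (fun y => (y : ℕ)) n
      fun y _ => y.2.le
  have hw := w.2
  rw [h.nbrSum]
  nlinarith

end RAM

namespace RAM

variable {n : ℕ} {T R : SimpleGraph (Fin n)} [DecidableRel T.Adj] [DecidableRel R.Adj]
  {d : Data n} {u v : Fin n}

/-! ### Removing leaves -/

/-- The data `d` are those of a machine that has deleted edges of `T` until `R` remained: `d.cut z`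
counts the vertices that the deleted edges at `z` cut off, and `d.acc` is the sum of the weights of
all deleted edges. -/
structure Peeling (T R : SimpleGraph (Fin n)) [DecidableRel T.Adj] [DecidableRel R.Adj]
    (d : Data n) : Prop where
  le : R ≤ T
  degree : ∀ z, d.degree z = T.degree z
  current : ∀ z, d.current z = R.degree z
  nbrSum : ∀ z, d.nbrSum z = ∑ w ∈ R.neighborFinset z, (w : ℕ)
  cut : ∀ z, R.degree z ≠ 0 → d.cut z + ∑ w ∈ R.neighborFinset z, (side T z w).card + 1 = n
  prod : d.prod = ∏ z, ((T.degree z)! : ℚ)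
  acc : d.acc + ∑ e ∈ R.edgeFinset, (planarWeight T e : ℚ) =
    ∑ e ∈ T.edgeFinset, (planarWeight T e : ℚ)

theorem Records.peeling (h : Records T d) (hT : T.IsTree) :
    Peeling T T { d with counter := 0 } where
  le := le_rfl
  degree := h.degree
  current := h.current
  nbrSum := h.nbrSum
  cut z _ := by simpa [h.cut z] using sum_card_side_add_one hT z
  prod := by simp only [h.prod, h.degree]
  acc := by simp only [h.acc, zero_add]

theorem Peeling.look (h : Peeling T R d) : Peeling T R d.look :=
  ⟨h.1, h.2, h.3, h.4, h.5, h.6, h.7⟩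

theorem Peeling.nbrSum_eq (h : Peeling T R d) (hd : R.degree v = 1) (hvu : R.Adj v u) :
    d.nbrSum v = u := by
  rw [h.nbrSum, neighborFinset_eq_singleton_of_degree_eq_one hd hvu, Finset.sum_singleton]

theorem Peeling.cut_add_one (h : Peeling T R d) (hT : T.IsTree) (hd : R.degree v = 1)
    (hvu : R.Adj v u) : d.cut v + 1 = (side T u v).card := by
  have hcut := h.cut v (hd.trans_ne one_ne_zero)
  have hadd := card_side_add_card_side hT (h.le hvu)
  rw [neighborFinset_eq_singleton_of_degree_eq_one hd hvu, Finset.sum_singleton] at hcut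
  rw [Fintype.card_fin] at hadd
  omega

theorem Peeling.cut_add_sum_deleteEdges [DecidableRel (R.deleteEdges {s(v, u)}).Adj]
    (h : Peeling T R d) (hT : T.IsTree) (hd : R.degree v = 1) (hvu : R.Adj v u) :
    d.cut u + (d.cut v + 1) +
      ∑ w ∈ (R.deleteEdges {s(v, u)}).neighborFinset u, (side T u w).card + 1 = n := by
  have hcut := h.cut u ((R.degree_pos_iff_exists_adj u).2 ⟨v, hvu.symm⟩).ne'
  rw [sum_neighborFinset_deleteEdges_singleton hvu, if_neg hvu.ne', if_pos rfl] at hcut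
  rw [h.cut_add_one hT hd hvu]
  omega

theorem Peeling.acc_weigh (h : Peeling T R d) (hT : T.IsTree) (hd : R.degree v = 1)
    (hvu : R.Adj v u) : (d.weigh v u).acc = d.acc + planarWeight T s(v, u) := by
  have hadj := h.le hvu
  have hcut : (d.cut v : ℚ) + 1 = (side T u v).card := mod_cast h.cut_add_one hT hd hvu
  have hrest : (n : ℚ) - (side T u v).card = (side T v u).card := by
    rw [sub_eq_iff_eq_add]
    exact mod_cast (Fintype.card_fin n).symm.trans (card_side_add_card_side hT hadj).symm
  have hv : 1 ≤ T.degree v := (T.degree_pos_iff_exists_adj v).2 ⟨u, hadj⟩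
  have hu : 1 ≤ T.degree u := (T.degree_pos_iff_exists_adj u).2 ⟨v, hadj.symm⟩
  simp only [Data.weigh, planarWeight_mk, h.degree, hcut, hrest, Nat.cast_sub hv, Nat.cast_sub hu]
  push_cast
  ring

theorem Peeling.detach [DecidableRel (R.deleteEdges {s(v, u)}).Adj]
    (h : Peeling T R d) (hT : T.IsTree) (hd : R.degree v = 1) (hvu : R.Adj v u) :
    Peeling T (R.deleteEdges {s(v, u)}) ((d.weigh v u).detach v u) := by
  have hne : v ≠ u := hvu.ne
  have hdeg := degree_deleteEdges_singleton hvu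
  refine ⟨(R.deleteEdges_le _).trans h.le, h.degree, fun z => ?_, fun z => ?_, fun z hz => ?_,
    h.prod, ?_⟩
  · have := hdeg z
    rcases eq_or_ne z v with rfl | hv <;> rcases eq_or_ne z u with rfl | hu <;>
      simp_all [Data.weigh, Data.detach, h.current]
  · have hsum := sum_neighborFinset_deleteEdges_singleton hvu (fun w => (w : ℕ)) z
    rw [← h.nbrSum z] at hsum
    rcases eq_or_ne z u with rfl | hzu
    · rw [if_neg hne.symm, if_pos rfl, zero_add] at hsum
      simp [Data.weigh, Data.detach, hsum]
    rcases eq_or_ne z v with rfl | hzv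
    · rw [if_pos rfl, if_neg hne, h.nbrSum_eq hd hvu] at hsum
      have hzero : ∑ w ∈ (R.deleteEdges {s(z, u)}).neighborFinset z, (w : ℕ) = 0 := by omega
      rw [hzero]
      simp [Data.weigh, Data.detach, hne]
    · simpa [Data.weigh, Data.detach, hzu, hzv] using hsum
  · rcases eq_or_ne z u with rfl | hzu
    · simpa [Data.weigh, Data.detach] using h.cut_add_sum_deleteEdges hT hd hvu
    · have hzv : z ≠ v := by
        rintro rfl
        have := hdeg z
        simp_all
      have hdz := hdeg z
      have hsum := sum_neighborFinset_deleteEdges_singleton hvu (fun w => (side T z w).card) z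
      rw [if_neg hzv, if_neg hzu, add_zero, add_zero] at hdz hsum
      simpa [Data.weigh, Data.detach, hzu, hsum] using h.cut z (hdz.trans_ne hz)
  · have hsum := sum_edgeFinset_deleteEdges_singleton hvu fun e => (planarWeight T e : ℚ)
    rw [← h.acc, hsum, ← add_assoc, ← h.acc_weigh hT hd hvu]
    rfl

end RAM

/-! ### Running the program -/

namespace RAM

variable {n S W C k : ℕ} {T : SimpleGraph (Fin n)} {l : List (Fin n × Fin n)} {σ : State}

theorem Test.holds_wordLt {x y : ℕ} : (Test.wordLt x y).Holds σ ↔ σ.word x < σ.word y := .rfl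

theorem Test.holds_numLt {x y : ℕ} : (Test.numLt x y).Holds σ ↔ σ.num x < σ.num y := .rfl

/-- The invariant of `readProg`: the first `d.counter` edges have been read, and the credit
suffices to read the others and leaves `C`. -/
def Reading (l : List (Fin n × Fin n)) (C k : ℕ) (σ : State) : Prop :=
  ∃ (d : Data n) (R : SimpleGraph (Fin n)) (_ : DecidableRel R.Adj),
    Represents l d σ ∧ d.counter ≤ l.length ∧ IsEdgeList R (l.take d.counter) ∧ Records R d ∧
      22 * (l.length - d.counter) + C + 1 ≤ k

theorem readBlock_runs (hT : T.IsTree) (hl : IsEdgeList T l) (hS : n ≤ S) (hW : n * n + n < W)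
    (h : Reading l C (k + 1) σ) (hlt : (Test.wordLt 2 6).Holds σ) :
    Runs S W (block readBlock) k σ (Reading l C) := by
  obtain ⟨d, R, _, hσ, -, hR, hd, hk⟩ := h
  have hlen := hl.length_add_one hT
  rw [Test.holds_wordLt, hσ.counter, hσ.size] at hlt
  have hi : d.counter < l.length := by omega
  obtain ⟨R', _, hadj, hR', hd'⟩ := hd.exists_record hl hi hR
  have hblock : readBlock.length = 21 := rfl
  refine Runs.block ?_ (by omega) ⟨_, R', _, hσ.readBlock hi, hi, hR', hd', ?_⟩
  · refine readBlock_legal hσ hi hadj.ne hS (by omega) (by omega) (fun z => ?_) fun z w => ?_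
    · have hdeg := R.degree_lt_card_verts z
      rw [Fintype.card_fin] at hdeg
      rw [hd.degree]
      omega
    · have hsum := hd.nbrSum_add_lt z w
      omega
  · simp only [Data.next, Data.record]
    omega

theorem readProg_runs (hT : T.IsTree) (hl : IsEdgeList T l) (hS : n ≤ S) (hW : n * n + n < W)
    (h : Represents l ⟨0, 0, 0, 0, 0, 1, 1, 0⟩ σ) (hk : 22 * l.length + C + 1 ≤ k) :
    Runs S W readProg k σ fun k' σ' => ∃ (d : Data n) (_ : DecidableRel T.Adj),
      Represents l d σ' ∧ Records T d ∧ C ≤ k' := by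
  classical
  have hnil : IsEdgeList (⊥ : SimpleGraph (Fin n)) (l.take 0) := by simp [IsEdgeList]
  refine (Runs.loop (fun k σ hσ hlt => readBlock_runs (C := C) hT hl hS hW hσ hlt) ?_
    ⟨_, ⊥, _, h, Nat.zero_le _, hnil, .bot, hk⟩).mono ?_
  · rintro k σ ⟨d, R, _, -, -, -, -, hk⟩
    omega
  · rintro k σ ⟨hlt, d, R, inst, hσ, hi, hR, hd, hk⟩
    rw [Test.holds_wordLt, hσ.counter, hσ.size] at hlt
    have hlen := hl.length_add_one hT
    rw [List.take_of_length_le (by omega)] at hR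
    obtain rfl := hl.unique hR
    exact ⟨d, inst, hσ, hd, by omega⟩

section Peel

variable [DecidableRel T.Adj]

/-- The invariant of `peelProg`: among the first `d.counter` vertices there is no leaf left, and
the credit suffices to delete the remaining edges and leaves `C`. -/
def Pruning (T : SimpleGraph (Fin n)) [DecidableRel T.Adj] (l : List (Fin n × Fin n)) (C k : ℕ)
    (σ : State) : Prop :=
  ∃ (d : Data n) (R : SimpleGraph (Fin n)) (_ : DecidableRel R.Adj),
    Represents l d σ ∧ Peeling T R d ∧ d.fact = (d.counter ! : ℚ) ∧ d.counter ≤ n ∧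
      (∀ z : Fin n, z < d.counter → R.degree z ≠ 1) ∧
      37 * R.edgeFinset.card + 10 * (n - d.counter) + C + 1 ≤ k

/-- The invariant of `peelLoop`: among the first `d.counter` vertices, only the one that is being
looked at can be a leaf. -/
def PruningAt (T : SimpleGraph (Fin n)) [DecidableRel T.Adj] (l : List (Fin n × Fin n)) (C k : ℕ)
    (σ : State) : Prop :=
  ∃ (d : Data n) (R : SimpleGraph (Fin n)) (_ : DecidableRel R.Adj) (v : Fin n),
    Represents l d σ ∧ Looking d v σ ∧ Peeling T R d ∧ d.fact = (d.counter ! : ℚ) ∧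
      d.counter ≤ n ∧ (∀ z : Fin n, z < d.counter → z ≠ v → R.degree z ≠ 1) ∧
      37 * R.edgeFinset.card + 10 * (n - d.counter) + C + 2 ≤ k

theorem Looking.lt_iff {d : Data n} {v : Fin n} (h : Looking d v σ) (hσ : Represents l d σ) :
    (Test.wordLt 9 1).Holds σ ↔ d.current v = 1 := by
  rw [Test.holds_wordLt, h.2, hσ.one]
  omega

theorem peelBlock_runs (hT : T.IsTree) (hS : n ≤ S) (hW : n < W)
    (h : PruningAt T l C (k + 1) σ) (hlt : (Test.wordLt 9 1).Holds σ) :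
    Runs S W (block peelBlock) k σ (PruningAt T l C) := by
  obtain ⟨d, R, _, v, hσ, hv, hd, hfact, hn, hleaf, hk⟩ := h
  have hdv : R.degree v = 1 := (hd.current v).symm.trans ((hv.lt_iff hσ).1 hlt)
  obtain ⟨u, hvu⟩ := (R.degree_pos_iff_exists_adj v).1 (hdv.symm ▸ one_pos)
  have hnbr := hd.nbrSum_eq hdv hvu
  have huv : (u : ℕ) ≠ v := fun huv => hvu.ne (Fin.ext huv).symm
  have hcard := sum_edgeFinset_deleteEdges_singleton hvu fun _ => 1
  rw [← Finset.card_eq_sum_ones, ← Finset.card_eq_sum_ones] at hcard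
  have hblock : peelBlock.length = 36 := rfl
  refine Runs.block ?_ (by omega) ⟨_, R.deleteEdges {s(v, u)}, _, u,
    hσ.peelBlock hv.1 hnbr huv, looking_run_peelBlock hσ hv.1 hnbr huv, hd.detach hT hdv hvu,
    hfact, hn, fun z hz hzu => ?_, ?_⟩
  · have hcut := hd.cut_add_sum_deleteEdges hT hdv hvu
    have hu := R.degree_lt_card_verts u
    rw [Fintype.card_fin] at hu
    exact peelBlock_legal hσ hv.1 hnbr huv hS hW (hd.current u ▸ hu.trans hW) (by omega)
  · have hdeg := degree_deleteEdges_singleton hvu z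
    rw [if_neg hzu] at hdeg
    rcases eq_or_ne z v with rfl | hzv
    · rw [if_pos rfl] at hdeg
      omega
    · rw [if_neg hzv] at hdeg
      have := hleaf z hz hzv
      omega
  · simp only [Data.weigh, Data.detach]
    omega

theorem peelLoop_runs (hT : T.IsTree) (hS : n ≤ S) (hW : n < W) (h : PruningAt T l C k σ) :
    Runs S W peelLoop k σ (Pruning T l C) := by
  refine (Runs.loop (fun k σ hσ hlt => peelBlock_runs hT hS hW hσ hlt) ?_ h).mono ?_
  · rintro k σ ⟨d, R, _, v, -, -, -, -, -, -, hk⟩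
    omega
  · rintro k σ ⟨hlt, d, R, inst, v, hσ, hv, hd, hfact, hn, hleaf, hk⟩
    refine ⟨d, R, inst, hσ, hd, hfact, hn, fun z hz => ?_, by omega⟩
    rcases eq_or_ne z v with rfl | hzv
    · rw [← hd.current]
      exact fun hone => hlt ((hv.lt_iff hσ).2 hone)
    · exact hleaf z hz hzv

theorem lookBlock_runs (hS : n ≤ S) (hW : n < W) (h : Pruning T l C (k + 1) σ)
    (hlt : (Test.wordLt 2 0).Holds σ) :
    Runs S W (block (lookBlock ++ testBlock)) k σ (PruningAt T l C) := by
  obtain ⟨d, R, _, hσ, hd, hfact, hn, hleaf, hk⟩ := h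
  rw [Test.holds_wordLt, hσ.counter, hσ.order] at hlt
  have h7 : (run lookBlock σ).word 7 = (⟨d.counter, hlt⟩ : Fin n) := word_run_lookBlock hσ
  have hblock : (lookBlock ++ testBlock).length = 8 := rfl
  have hdeg := R.degree_lt_card_verts ⟨d.counter, hlt⟩
  rw [Fintype.card_fin, ← hd.current] at hdeg
  refine Runs.block ((lookBlock_legal hσ (by omega)).append
    (testBlock_legal hσ.lookBlock h7 hS (by omega) (hdeg.trans hW))) (by omega) ?_
  rw [run_append]
  refine ⟨_, R, _, ⟨d.counter, hlt⟩, hσ.lookBlock.testBlock,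
    looking_run_testBlock hσ.lookBlock h7, hd.look, ?_, hlt, fun z hz hne => hleaf z ?_, ?_⟩
  · simp only [Data.look, hfact, Nat.factorial_succ]
    push_cast
    ring
  · exact lt_of_le_of_ne (Nat.lt_succ_iff.1 hz) fun hz => hne (Fin.ext hz)
  · simp only [Data.look]
    omega

theorem peelProg_runs (hT : T.IsTree) (hS : n ≤ S) (hW : n < W) (h : Pruning T l C k σ) :
    Runs S W peelProg k σ fun k' σ' => ∃ d : Data n, Represents l d σ' ∧ d.fact = (n ! : ℚ) ∧
      d.prod = ∏ z, ((T.degree z)! : ℚ) ∧ d.acc = ∑ e ∈ T.edgeFinset, (planarWeight T e : ℚ) ∧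
      C ≤ k' := by
  refine (Runs.loop (fun k σ hσ hlt => (lookBlock_runs hS hW hσ hlt).seq
    fun k σ hσ => peelLoop_runs hT hS hW hσ) ?_ h).mono ?_
  · rintro k σ ⟨d, R, _, -, -, -, -, -, hk⟩
    omega
  · rintro k σ ⟨hlt, d, R, _, hσ, hd, hfact, hn, hleaf, hk⟩
    rw [Test.holds_wordLt, hσ.counter, hσ.order] at hlt
    have hbot := eq_bot_of_degree_ne_one hT hd.le fun z => hleaf z (z.2.trans_le (not_lt.1 hlt))
    refine ⟨d, hσ, ?_, hd.prod, ?_, by omega⟩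
    · rw [hfact, le_antisymm hn (not_lt.1 hlt)]
    · simpa [SimpleGraph.edgeFinset_eq_empty.2 hbot] using hd.acc

theorem finish_runs (hT : T.IsTree) {d : Data n} (h : Represents l d σ)
    (hfact : d.fact = (n ! : ℚ)) (hprod : d.prod = ∏ z, ((T.degree z)! : ℚ))
    (hacc : d.acc = ∑ e ∈ T.edgeFinset, (planarWeight T e : ℚ)) (hk : 18 ≤ k) :
    Runs S W (.seq (block finishBlock) (.ite (.numLt 10 5) (block [.numDiv 0 8 5]) .skip)) k σ
      fun _ σ' => (∃ π : Arrangement (Fin n), 1 ≤ crossings T π) →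
        (σ'.num 0 : ℝ) = expSumLengthsCrossing T := by
  obtain ⟨h10, h5, h8⟩ := num_run_finishBlock h
  have hblock : finishBlock.length = 16 := rfl
  refine Runs.seq (Q := fun k' σ' => 2 ≤ k' ∧ σ' = run finishBlock σ)
    (Runs.block finishBlock_legal (by omega) ⟨by omega, rfl⟩) ?_
  rintro k σ' ⟨hk, rfl⟩
  obtain ⟨k, rfl⟩ := Nat.exists_eq_add_of_le' (one_le_two.trans hk)
  refine Runs.ite_skip (fun hpos => Runs.block ⟨?_, trivial⟩ (Nat.le_of_succ_le_succ hk)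
    fun hcross => ?_) fun hneg hcross => absurd ?_ hneg
  · rw [Test.holds_numLt] at hpos
    exact (h10 ▸ hpos).ne'
  · have hquot : (run [.numDiv 0 8 5] (run finishBlock σ)).num 0 =
        (run finishBlock σ).num 8 / (run finishBlock σ).num 5 := by
      simp [run, Instr.apply]
    rw [hquot, h5, h8, hfact, hprod, hacc, expSumLengthsCrossing_eq_div hT hcross,
      Fintype.card_fin]
    push_cast
    rfl
  · have hlt := card_mul_prod_factorial_degree_lt hT hcross
    rw [Fintype.card_fin] at hlt
    have hlt' : (n : ℚ) * ∏ z, ((T.degree z)! : ℚ) < (n ! : ℚ) := mod_cast hlt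
    rw [Test.holds_numLt, h10, h5, hfact, hprod]
    linarith

theorem Records.pruning {d : Data n} (hd : Records T d) (hT : T.IsTree) (h : Represents l d σ)
    (hk : 47 * n + C ≤ k + 36) : Pruning T l C k (run [.wordSub 2 2 2] σ) := by
  have hcard := hT.card_edgeFinset
  rw [Fintype.card_fin] at hcard
  refine ⟨_, T, _, h.wordSub_counter, hd.peeling hT, ?_, n.zero_le,
    fun z hz => absurd hz (Nat.not_lt_zero z), ?_⟩
  · rw [hd.fact, Nat.factorial_zero, Nat.cast_one]
  · dsimp only
    omega

end Peel

theorem crossingProg_runs (hT : T.IsTree) (hl : IsEdgeList T l) (hS : n ≤ S)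
    (hW : n * n + n < W) :
    Runs S W crossingProg (100 * n) (input l) fun _ σ =>
      (∃ π : Arrangement (Fin n), 1 ≤ crossings T π) →
        (σ.num 0 : ℝ) = expSumLengthsCrossing T := by
  have hlen := hl.length_add_one hT
  have hinit : initBlock.length = 4 := rfl
  have hreset : [Instr.wordSub 2 2 2].length = 1 := rfl
  refine (Runs.block (Q := fun k σ => 100 * n ≤ k + 4 ∧
    Represents l ⟨0, 0, 0, 0, 0, 1, 1, 0⟩ σ) (initBlock_legal (by nlinarith)) (by omega)
    ⟨by omega, .initBlock l⟩).seq ?_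
  rintro k σ ⟨hk, hσ⟩
  refine (readProg_runs (C := 48 * n + 20) hT hl hS hW hσ (by omega)).seq ?_
  rintro k σ ⟨d, _, hσ, hd, hk⟩
  have hprune : Pruning T l 18 (k - 1) (run [.wordSub 2 2 2] σ) :=
    hd.pruning hT hσ (by omega)
  refine (Runs.block (show BlockLegal S W [.wordSub 2 2 2] σ from ⟨trivial, trivial⟩) (by omega)
    hprune).seq fun k σ hσ => ?_
  refine (peelProg_runs hT hS (by omega) hσ).seq ?_
  rintro k σ ⟨d, hσ, hfact, hprod, hacc, hk⟩
  exact finish_runs hT hσ hfact hprod hacc hk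

end RAM

theorem exists_crossings_eq_zero {V : Type*} [Fintype V] {T : SimpleGraph V} (hT : T.IsTree) :
    ∃ π : Arrangement V, crossings T π = 0 := by
  classical
  have := hT.1.nonempty
  have hpos : 0 < numPlanar T := numPlanar_eq hT ▸ by positivity
  exact Set.nonempty_of_ncard_ne_zero hpos.ne'

theorem mainTheorem6_general :
    (∀ (V : Type*) [Fintype V] (T : SimpleGraph V),
      probNoCrossing T = (numPlanar T : ℝ) / ((Fintype.card V)! : ℝ) ∧
      probCrossing T =
        (((Fintype.card V)! : ℝ) - (numPlanar T : ℝ)) / ((Fintype.card V)! : ℝ) ∧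
      ((∃ π : Arrangement V, crossings T π = 0) → (∃ π : Arrangement V, 1 ≤ crossings T π) →
        0 < probCrossing T ∧
        expSumLengthsCrossing T =
          (expSumLengths T - expSumLengthsPlanar T * probNoCrossing T) / probCrossing T)) ∧
    (∃ (p : RAM.Prog) (K : ℕ), ∀ (n : ℕ) (T : SimpleGraph (Fin n)), T.IsTree →
      ∀ l : List (Fin n × Fin n), RAM.IsEdgeList T l →
        ∃ (t : ℕ) (σ : RAM.State),
          RAM.Exec (K * n) ((n + 1) ^ K) p (RAM.input l) t σ ∧ t ≤ K * n ∧
          ((∃ π : Arrangement (Fin n), 1 ≤ crossings T π) →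
            (σ.num 0 : ℝ) = expSumLengthsCrossing T)) := by
  refine ⟨fun V _ T => ⟨probNoCrossing_eq T, probCrossing_eq T,
    fun _ hcross => ⟨probCrossing_pos hcross, expSumLengthsCrossing_eq hcross⟩⟩,
    RAM.crossingProg, 100, fun n T hT l hl => ?_⟩
  have hword : n * n + n < (n + 1) ^ 100 :=
    calc n * n + n < (n + 1) ^ 2 := by nlinarith
      _ ≤ (n + 1) ^ 100 := Nat.pow_le_pow_right n.succ_pos (by norm_num)
  obtain ⟨t, σ, _, hexec, ht, hσ⟩ := RAM.crossingProg_runs (S := 100 * n) hT hl (by omega) hword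
  exact ⟨t, σ, hexec, by omega, hσ⟩

theorem mainTheorem6 :
    -- the formula, for every free tree
    (∀ (V : Type*) [Fintype V] (T : SimpleGraph V), T.IsTree →
      probNoCrossing T = (numPlanar T : ℝ) / ((Fintype.card V)! : ℝ) ∧
      probCrossing T =
        (((Fintype.card V)! : ℝ) - (numPlanar T : ℝ)) / ((Fintype.card V)! : ℝ) ∧
      ((∃ π : Arrangement V, 1 ≤ crossings T π) →
        0 < probCrossing T ∧
        expSumLengthsCrossing T =
          (expSumLengths T - expSumLengthsPlanar T * probNoCrossing T) / probCrossing T)) ∧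
    -- one program computes the conditional expectation in linear time and linear space,
    -- on words of logarithmic length
    (∃ (p : RAM.Prog) (K : ℕ), ∀ (n : ℕ) (T : SimpleGraph (Fin n)), T.IsTree →
      ∀ l : List (Fin n × Fin n), RAM.IsEdgeList T l →
        ∃ (t : ℕ) (σ : RAM.State),
          RAM.Exec (K * n) ((n + 1) ^ K) p (RAM.input l) t σ ∧ t ≤ K * n ∧
          ((∃ π : Arrangement (Fin n), 1 ≤ crossings T π) →
            (σ.num 0 : ℝ) = expSumLengthsCrossing T)) := by
  obtain ⟨hformula, hprogram⟩ := mainTheorem6_general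
  refine ⟨fun V _ T hT => ?_, hprogram⟩
  obtain ⟨hno, hcross, hexp⟩ := hformula V T
  exact ⟨hno, hcross, hexp (exists_crossings_eq_zero hT)⟩
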